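/- Call a deterministic finite automaton $A=(Q,\Sigma,\cdot,i,F)$ \emph{minimal} if all its states are reachable from $i$ and any two distinct states are distinguishable (some word is accepted from exactly one of them). A language over a finite alphabet $\Sigma$ is \emph{$1$-piecewise testable} ($1$-PT) if it is a finite boolean combination of languages of the form $\Sigma^*a_1\Sigma^*\cdots\Sigma^*a_n\Sigma^*$ with $0\le n\le 1$ and $a_i\in\Sigma$. \textbf{Theorem.} (1) The problem of deciding whether a given minimal DFA recognizes a $1$-PT language is in LOGSPACE. That is, encode a DFA with states $0,\dots,n-1$ and letters $0,\dots,m-1$ as a word over a fixed finite alphabet by listing $n$, $m$, the initial state, the accepting states and all transitions $(p,a,p\cdot a)$, with all numbers in binary. Then there is a deterministic Turing machine, with a two-way read-only input tape and finitely many work tapes, that halts on every input word $x$ using $O(1+\log(1+|x|))$ cells of its work tapes and that, for every minimal DFA $A$, accepts the encoding of $A$ if and only if $L(A)$ is $1$-PT. (2) For every minimal DFA $A=(Q,\Sigma,\cdot,i,F)$ with $Q$ and $\Sigma$ finite, $L(A)$ is $1$-PT if and only if both of the following hold: (i) for all $p,q\in Q$ and $a\in\Sigma$, $p\cdot a=q$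 implies $q\cdot a=q$; (ii) for all $p\in Q$ and $a,b\in\Sigma$, $p\cdot ab=p\cdot ba$. -/

import Mathlib

/-! Piecewise testable languages -/

/-- The language `Σ* a₁ Σ* a₂ Σ* ⋯ Σ* aₙ Σ*` of a word `a₁ a₂ ⋯ aₙ`
(here `⊤` is the language `Σ*` of all words). -/
def subseqLanguage {α : Type*} : List α → Language α
  | [] => ⊤
  | a :: v => ⊤ * ({[a]} * subseqLanguage v)

/-- A language is `k`-piecewise testable (`k`-PT) if it is a finite boolean combination of
languages `Σ* a₁ Σ* ⋯ Σ* aₙ Σ*` with `0 ≤ n ≤ k`, i.e. if it lies in the boolean subalgebra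
generated by these languages. Over a finite alphabet such a language is automatically regular. -/
def IsPiecewiseTestable {α : Type*} (k : ℕ) (L : Language α) : Prop :=
  L ∈ BooleanSubalgebra.closure {K : Language α | ∃ v : List α, v.length ≤ k ∧ K = subseqLanguage v}

/-- A DFA is minimal if all its states are reachable and pairwise distinguishable. -/
def DFA.IsMinimal {α σ : Type*} (A : DFA α σ) : Prop :=
  (∀ q : σ, ∃ w : List α, A.eval w = q) ∧
    ∀ p q : σ, p ≠ q → ∃ w : List α, ¬ (A.evalFrom p w ∈ A.accept ↔ A.evalFrom q w ∈ A.accept)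

/-! Deterministic logarithmic space: Turing machines with a two-way read-only input tape, whose
space usage is measured on separate work tapes -/

/-- Contents of a cell of the input tape, on which the input word is written between two
end markers. -/
inductive InputCell (Γ : Type) : Type
  | leftEnd : InputCell Γ
  | letter (a : Γ) : InputCell Γ
  | rightEnd : InputCell Γ

/-- The cell at position `i` of the input tape `⊢ x₁ ⋯ xₙ ⊣` of the word `x = x₁ ⋯ xₙ`:
position `0` holds the left end marker, positions `1, …, n` hold the letters of `x`, and position
`n + 1` holds the right end marker. -/
def inputCell {Γ : Type} (x : List Γ) : ℕ → InputCell Γ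
  | 0 => .leftEnd
  | i + 1 => match x[i]? with
    | some a => .letter a
    | none => .rightEnd

/-- A movement of a tape head. -/
inductive HeadMove : Type
  | left : HeadMove
  | stay : HeadMove
  | right : HeadMove

/-- The new position of a head on a tape with cells `0, 1, 2, …`; a head on cell `0` that is
told to move left stays where it is. -/
def HeadMove.apply : HeadMove → ℕ → ℕ
  | .left, i => i - 1
  | .stay, i => i
  | .right, i => i + 1

/-- A deterministic Turing machine with input alphabet `Γ`, a two-way read-only input tape and
finitely many read-write work tapes, each infinite to the right. -/
structure OfflineTM (Γ : Type) where
  /-- The finite set of control states. -/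
  State : Type
  finite_state : Finite State
  /-- The finite work alphabet. -/
  Work : Type
  finite_work : Finite Work
  /-- The blank symbol of the work tapes. -/
  blank : Work
  /-- The number of work tapes. -/
  tapes : ℕ
  /-- The initial state. -/
  start : State
  /-- The accepting states: a computation that halts accepts iff its last state is accepting. -/
  accept : Set State
  /-- The transition function. Given the state, the scanned input cell and the scanned work
  symbols, the machine either halts (`none`) or goes to a new state, moves its input head, and on
  each work tape writes a symbol and moves the head. -/
  trans : State → InputCell Γ → (Fin tapes → Work) →
    Option (State × HeadMove × (Fin tapes → Work × HeadMove))

namespace OfflineTM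

/-- A configuration of a machine (the input word, which never changes, is not part of it). -/
structure Cfg {Γ : Type} (M : OfflineTM Γ) where
  /-- The current control state. -/
  state : M.State
  /-- The position of the input head. -/
  inputHead : ℕ
  /-- The positions of the heads on the work tapes. -/
  workHead : Fin M.tapes → ℕ
  /-- The contents of the work tapes. -/
  work : Fin M.tapes → ℕ → M.Work

/-- The initial configuration: all heads are on cell `0` and all work tapes are blank. -/
def init {Γ : Type} (M : OfflineTM Γ) : M.Cfg where
  state := M.start
  inputHead := 0
  workHead := fun _ => 0
  work := fun _ _ => M.blank

/-- One step of the machine on input `x`, or `none` if the machine halts. The input head never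
leaves the cells `0, …, |x| + 1`. -/
def step {Γ : Type} (M : OfflineTM Γ) (x : List Γ) (c : M.Cfg) : Option M.Cfg :=
  (M.trans c.state (inputCell x c.inputHead) (fun t => c.work t (c.workHead t))).map
    fun r =>
      { state := r.1
        inputHead := min (r.2.1.apply c.inputHead) (x.length + 1)
        workHead := fun t => (r.2.2 t).2.apply (c.workHead t)
        work := fun t => Function.update (c.work t) (c.workHead t) (r.2.2 t).1 }

/-- The machine halts on input `x`. -/
def Halts {Γ : Type} (M : OfflineTM Γ) (x : List Γ) : Prop :=
  (StateTransition.eval (M.step x) M.init).Dom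

/-- The machine halts on input `x` in an accepting state. -/
def Accepts {Γ : Type} (M : OfflineTM Γ) (x : List Γ) : Prop :=
  ∃ c ∈ StateTransition.eval (M.step x) M.init, c.state ∈ M.accept

/-- On input `x` the machine visits at most the first `s` cells of each of its work tapes. -/
def UsesSpaceAtMost {Γ : Type} (M : OfflineTM Γ) (x : List Γ) (s : ℕ) : Prop :=
  ∀ c : M.Cfg, StateTransition.Reaches (M.step x) M.init c → ∀ t, c.workHead t < s

end OfflineTM

/-- The class LOGSPACE of languages (over finite alphabets) that are decided by a deterministic
Turing machine which halts on every input and uses space `O(log n)` on inputs of length `n`. -/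
def InLOGSPACE {Γ : Type} [Finite Γ] (L : Language Γ) : Prop :=
  ∃ M : OfflineTM Γ,
    (∀ x : List Γ, M.Halts x ∧ (M.Accepts x ↔ x ∈ L)) ∧
      ∃ C : ℕ, ∀ x : List Γ, M.UsesSpaceAtMost x (C * (Nat.log 2 x.length + 1))

/-! DFAs as inputs of a machine. The alphabet `Computability.Γ'` consists of two bits, two
brackets, a comma and a blank. -/

open Computability in
/-- A natural number in binary (least significant bit first), followed by a comma. -/
def encodeNumber (k : ℕ) : List Γ' :=
  (Nat.bits k).map Γ'.bit ++ [Γ'.comma]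

open Computability Classical in
/-- The encoding of a DFA with letters `0, …, m - 1` and states `0, …, n - 1` as a word: the
numbers `n` and `m`, the initial state, the bracketed list of the accepting states, and the
transition table as the list of all `[p, a, p·a]`. -/
noncomputable def encodeDFA {m n : ℕ} (A : DFA (Fin m) (Fin n)) : List Γ' :=
  encodeNumber n ++ encodeNumber m ++ encodeNumber A.start ++
    [Γ'.bra] ++
    ((List.finRange n).filter fun q : Fin n => decide (q ∈ A.accept)).flatMap (fun q : Fin n => encodeNumber q) ++
    [Γ'.ket] ++
    (List.finRange n).flatMap fun p : Fin n => (List.finRange m).flatMap fun a : Fin m =>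
      [Γ'.bra] ++ encodeNumber p ++ encodeNumber a ++ encodeNumber (A.step p a) ++ [Γ'.ket]

/-!
The characterization: over a finite alphabet, a language is `1`-piecewise testable iff membership
of a word depends only on the set of its letters (`IsPiecewiseTestable.mem_iff_of_letters`,
`isPiecewiseTestable_one_of_letters`). In a minimal DFA, two words with the same set of letters
then lead from each state to the same state, as otherwise these states could be distinguished; this
gives the two identities for the words `aa`, `a` and `ab`, `ba`. Conversely, the identities say that
the letters act as commuting idempotents, so that letters of a word may be permuted and repetitions
may be dropped (`DFA.evalFrom_eq_of_letters`).

Logarithmic space: the two identities are first-order statements about positions of the encoding, in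
which one can ask for the letter at a position, or at the sum of two positions, and for
the order of positions (`DFAEncoding.CommutingIdempotents`). The sums serve to compare two numbers
digit by digit. Such statements are decidable in logarithmic space, as a machine can go through
all values of the quantified variables, with one work tape for the binary notation of each
variable.

The machines are put together from routines, machine fragments with two exits. There
are only two ways of combining them, `Routine.ite` and `Routine.loop`, and the only routines that
touch the work tapes are those for adding and subtracting one, `Routine.inc` and `Routine.dec`. In
particular, the input head reaches a position by counting down the number that describes
the position, while a scratch tape keeps a copy. The class `Routine.LogDecidable` of predicates
that are decided by routines contains the atomic statements above and is closed under boolean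
operations and quantifiers bounded by the length of the input, and it leads to `InLOGSPACE` by
`Routine.LogDecidable.inLOGSPACE`.
-/

/-! ### Languages that depend only on the set of letters -/

theorem mem_subseqLanguage_singleton {α : Type*} (a : α) (w : List α) :
    w ∈ subseqLanguage [a] ↔ a ∈ w := by
  simp only [subseqLanguage, Language.mem_mul, List.mem_iff_append]
  constructor
  · rintro ⟨s, -, _, ⟨_, rfl, t, -, rfl⟩, rfl⟩
    exact ⟨s, t, rfl⟩
  · rintro ⟨s, t, rfl⟩
    exact ⟨s, trivial, a :: t, ⟨[a], rfl, t, trivial, rfl⟩, rfl⟩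

theorem IsPiecewiseTestable.mem_iff_of_letters {α : Type*} {L : Language α}
    (hL : IsPiecewiseTestable 1 L) {v w : List α} (h : ∀ a, a ∈ v ↔ a ∈ w) :
    v ∈ L ↔ w ∈ L := by
  induction hL using BooleanSubalgebra.closure_bot_sup_induction with
  | mem K hK =>
    obtain ⟨u, hu, rfl⟩ := hK
    match u, hu with
    | [], _ => exact Iff.rfl
    | [a], _ => simpa only [mem_subseqLanguage_singleton] using h a
  | bot => exact Iff.rfl
  | sup K _ K' _ ih ih' => exact or_congr ih ih'
  | compl K _ ih => exact not_congr ih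

/-- Over a finite alphabet, a language in which membership depends only on the set of letters is
a finite union of classes "the set of letters is `S`", and each class is a finite intersection of
languages `Σ* a Σ*` and of complements of such languages. -/
theorem isPiecewiseTestable_one_of_letters {α : Type*} [Finite α] {L : Language α}
    (h : ∀ v w : List α, (∀ a, a ∈ v ↔ a ∈ w) → v ∈ L → w ∈ L) :
    IsPiecewiseTestable 1 L := by
  classical
  have := Fintype.ofFinite α
  set 𝒮 := BooleanSubalgebra.closure
    {K : Language α | ∃ v : List α, v.length ≤ 1 ∧ K = subseqLanguage v} with h𝒮
  have hletter : ∀ a : α, subseqLanguage [a] ∈ 𝒮 := fun a =>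
    BooleanSubalgebra.subset_closure ⟨[a], by simp, rfl⟩
  let cls : Finset α → α → Language α := fun S a =>
    if a ∈ S then subseqLanguage [a] else (subseqLanguage [a])ᶜ
  have hcls : ∀ S a, cls S a ∈ 𝒮 := fun S a => by
    by_cases ha : a ∈ S
    · simpa [cls, ha] using hletter a
    · simpa [cls, ha] using hletter a
  let T : Finset (Finset α) := Finset.univ.filter fun S => ∃ v ∈ L, v.toFinset = S
  have hL : L = T.sup fun S => Finset.univ.inf (cls S) := by
    have hmem_inf : ∀ (S : Finset α) (U : Finset α) (w : List α),
        w ∈ U.inf (cls S) ↔ ∀ a ∈ U, w ∈ cls S a := by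
      intro S U w
      induction U using Finset.induction_on with
      | empty => simp only [Finset.inf_empty]; exact ⟨fun _ a ha => by simp at ha, fun _ => trivial⟩
      | insert a U _ ih =>
        rw [Finset.inf_insert, Finset.forall_mem_insert, ← ih]; exact Iff.rfl
    have hmem_sup : ∀ (T : Finset (Finset α)) (w : List α),
        w ∈ (T.sup fun S => Finset.univ.inf (cls S)) ↔
          ∃ S ∈ T, w ∈ Finset.univ.inf (cls S) := by
      intro T w
      induction T using Finset.induction_on with
      | empty => simp only [Finset.sup_empty]; exact ⟨fun h => h.elim, by simp⟩
      | insert a U _ ih =>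
        rw [Finset.sup_insert, Finset.exists_mem_insert, ← ih]; exact Iff.rfl
    have hmem_cls : ∀ (S : Finset α) (a : α) (w : List α),
        w ∈ cls S a ↔ (a ∈ w ↔ a ∈ S) := by
      intro S a w
      by_cases ha : a ∈ S
      · simp [cls, ha, mem_subseqLanguage_singleton]
      · simp only [cls, ha, if_false, iff_false]
        exact not_congr (mem_subseqLanguage_singleton a w)
    ext w
    rw [hmem_sup]
    simp only [hmem_inf, hmem_cls, Finset.mem_univ, true_imp_iff, T, Finset.mem_filter, true_and]
    constructor
    · intro hw
      exact ⟨w.toFinset, ⟨w, hw, rfl⟩, by simp⟩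
    · rintro ⟨S, ⟨v, hv, rfl⟩, hS⟩
      exact h v w (fun a => by simp [hS a]) hv
  rw [IsPiecewiseTestable, ← h𝒮, hL]
  refine Finset.sup_induction (BooleanSubalgebra.bot_mem) (fun _ ha _ hb => 𝒮.supClosed ha hb) ?_
  intro S _
  exact Finset.inf_induction (BooleanSubalgebra.top_mem) (fun _ ha _ hb => 𝒮.infClosed ha hb)
    fun a _ => hcls S a

/-- If the letters act as commuting idempotents, then the action of a word is determined by its
set of letters. -/
theorem DFA.evalFrom_eq_of_letters {α σ : Type*} (A : DFA α σ)
    (hidem : ∀ (p : σ) (a : α), A.step (A.step p a) a = A.step p a)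
    (hcomm : ∀ (p : σ) (a b : α), A.step (A.step p a) b = A.step (A.step p b) a)
    (p : σ) {v w : List α} (h : ∀ a, a ∈ v ↔ a ∈ w) : A.evalFrom p v = A.evalFrom p w := by
  classical
  have hperm : ∀ {v w : List α}, v.Perm w → ∀ p, A.evalFrom p v = A.evalFrom p w := by
    intro v w hvw p
    have : RightCommutative A.step := ⟨hcomm⟩
    exact hvw.foldl_eq p
  have hdedup : ∀ (v : List α) (p : σ), A.evalFrom p v.dedup = A.evalFrom p v := by
    intro v
    induction v with
    | nil => intro p; rfl
    | cons a l ih =>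
      intro p
      by_cases ha : a ∈ l
      · rw [List.dedup_cons_of_mem ha, ih]
        have hl := List.perm_cons_erase ha
        rw [hperm hl p, hperm (hl.cons a) p]
        simp only [DFA.evalFrom_cons, hidem]
      · rw [List.dedup_cons_of_notMem ha, DFA.evalFrom_cons, DFA.evalFrom_cons, ih]
  rw [← hdedup v, ← hdedup w]
  refine hperm ?_ p
  rw [List.perm_ext_iff_of_nodup v.nodup_dedup w.nodup_dedup]
  simpa using h

theorem DFA.IsMinimal.eq_of_forall_evalFrom {α σ : Type*} {A : DFA α σ} (hA : A.IsMinimal)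
    {p q : σ} (h : ∀ w, A.evalFrom p w ∈ A.accept ↔ A.evalFrom q w ∈ A.accept) : p = q := by
  by_contra hpq
  obtain ⟨w, hw⟩ := hA.2 p q hpq
  exact hw (h w)

theorem DFA.IsMinimal.isPiecewiseTestable_one_iff {α σ : Type*} [Finite α]
    {A : DFA α σ} (hA : A.IsMinimal) :
    IsPiecewiseTestable 1 A.accepts ↔
      (∀ (p q : σ) (a : α), A.step p a = q → A.step q a = q) ∧
      (∀ (p : σ) (a b : α), A.step (A.step p a) b = A.step (A.step p b) a) := by
  constructor
  · intro h
    have key : ∀ (p : σ) (v w : List α), (∀ a, a ∈ v ↔ a ∈ w) →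
        A.evalFrom p v = A.evalFrom p w := by
      intro p v w hvw
      obtain ⟨u, rfl⟩ := hA.1 p
      refine hA.eq_of_forall_evalFrom fun t => ?_
      have := h.mem_iff_of_letters (v := u ++ v ++ t) (w := u ++ w ++ t) (by simp [hvw])
      simpa only [DFA.mem_accepts, DFA.eval, DFA.evalFrom_of_append] using this
    constructor
    · rintro p _ a rfl
      exact key p [a, a] [a] (by simp)
    · intro p a b
      exact key p [a, b] [b, a] (by simp [or_comm])
  · rintro ⟨hidem, hcomm⟩
    refine isPiecewiseTestable_one_of_letters fun v w hvw hv => ?_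
    rw [DFA.mem_accepts] at hv ⊢
    rwa [DFA.eval, ← A.evalFrom_eq_of_letters (fun p a => hidem p _ a rfl) hcomm A.start hvw]

/-! ### Machine fragments with two exits -/

/-- The work alphabet: blanks, a mark for cell `0` of each tape, and binary digits. -/
inductive WorkSym : Type
  | blank : WorkSym
  | mark : WorkSym
  | bit (b : Bool) : WorkSym

instance : Finite WorkSym :=
  Finite.of_injective
    (fun s : WorkSym => match s with
      | .blank => (none : Option (Option Bool))
      | .mark => some none
      | .bit b => some (some b))
    (by rintro (_ | _ | _) (_ | _ | _) <;> simp)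

/-- The heads and the work tapes of a machine with `K` work tapes: a configuration without its
control state. -/
structure Mem (K : ℕ) : Type where
  /-- The position of the input head. -/
  inputHead : ℕ
  /-- The positions of the heads on the work tapes. -/
  heads : Fin K → ℕ
  /-- The contents of the work tapes. -/
  tapes : Fin K → ℕ → WorkSym

/-- A subroutine of a machine with `K` work tapes. It has one entry and two exits: instead of going
to a new state, it may leave with a truth value. -/
structure Routine (Γ : Type) (K : ℕ) where
  /-- The control states. -/
  State : Type
  finite_state : Finite State
  /-- The entry. -/
  start : State
  /-- The transition function; a value of `Bool` in place of a state is an exit. -/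
  next : State → InputCell Γ → (Fin K → WorkSym) →
    (State ⊕ Bool) × HeadMove × (Fin K → WorkSym × HeadMove)

namespace Routine

variable {Γ : Type} {K : ℕ}

/-- The effect of one transition of a machine on its heads and tapes. -/
def actOn (x : List Γ) (m : Mem K) (d : HeadMove) (r : Fin K → WorkSym × HeadMove) : Mem K where
  inputHead := min (d.apply m.inputHead) (x.length + 1)
  heads := fun t => (r t).2.apply (m.heads t)
  tapes := fun t => Function.update (m.tapes t) (m.heads t) (r t).1

/-- The transition of a routine that applies in the state `s`. -/
def nextAt (M : Routine Γ K) (x : List Γ) (s : M.State) (m : Mem K) :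
    (M.State ⊕ Bool) × HeadMove × (Fin K → WorkSym × HeadMove) :=
  M.next s (inputCell x m.inputHead) fun t => m.tapes t (m.heads t)

/-- One step of a routine, with all work heads among the first `B` cells before the step. -/
inductive Step (M : Routine Γ K) (x : List Γ) (B : ℕ) :
    (M.State ⊕ Bool) × Mem K → (M.State ⊕ Bool) × Mem K → Prop
  | mk (s : M.State) (m : Mem K) (hB : ∀ t, m.heads t < B) :
      Step M x B (.inl s, m)
        ((M.nextAt x s m).1, actOn x m (M.nextAt x s m).2.1 (M.nextAt x s m).2.2)

/-- Finitely many steps of a routine, with all work heads among the first `B` cells before each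
of them. -/
def Run (M : Routine Γ K) (x : List Γ) (B : ℕ) :
    (M.State ⊕ Bool) × Mem K → (M.State ⊕ Bool) × Mem K → Prop :=
  Relation.ReflTransGen (M.Step x B)

/-- The routine that runs `A` and goes on with `P` or with `Q` according to the exit of `A`. -/
def ite (A P Q : Routine Γ K) : Routine Γ K where
  State := A.State ⊕ (P.State ⊕ Q.State)
  finite_state := by
    have := A.finite_state
    have := P.finite_state
    have := Q.finite_state
    infer_instance
  start := .inl A.start
  next
    | .inl s, c, w =>
      let r := A.next s c w
      (match r.1 with
        | .inl s' => .inl (.inl s')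
        | .inr true => .inl (.inr (.inl P.start))
        | .inr false => .inl (.inr (.inr Q.start)), r.2)
    | .inr (.inl s), c, w =>
      let r := P.next s c w
      (r.1.map (fun s' => .inr (.inl s')) id, r.2)
    | .inr (.inr s), c, w =>
      let r := Q.next s c w
      (r.1.map (fun s' => .inr (.inr s')) id, r.2)

/-- The routine that repeats `A` as long as `A` leaves with `true`. It leaves with `true`. -/
def loop (A : Routine Γ K) : Routine Γ K where
  State := A.State
  finite_state := A.finite_state
  start := A.start
  next := fun s c w =>
    let r := A.next s c w
    (match r.1 with
      | .inl s' => .inl s'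
      | .inr true => .inl A.start
      | .inr false => .inr true, r.2)

/-- The routine that makes one step, which depends on the scanned input cell, moves only the input
head, and is an exit. -/
def basic (f : InputCell Γ → Bool × HeadMove) : Routine Γ K where
  State := Unit
  finite_state := inferInstance
  start := ()
  next := fun _ c w => (.inr (f c).1, (f c).2, fun t => (w t, .stay))

theorem run_ite_left (A P Q : Routine Γ K) {x : List Γ} {B : ℕ} {s : A.State} {m m' : Mem K}
    {b : Bool} (h : A.Run x B (.inl s, m) (.inr b, m')) :
    (ite A P Q).Run x B (.inl (.inl s), m)
      (.inl (.inr (bif b then .inl P.start else .inr Q.start)), m') := by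
  have := Relation.ReflTransGen.lift (p := (ite A P Q).Step x B)
    (fun c : (A.State ⊕ Bool) × Mem K => ((match c.1 with
        | .inl s' => .inl (.inl s')
        | .inr true => .inl (.inr (.inl P.start))
        | .inr false => .inl (.inr (.inr Q.start)) : (ite A P Q).State ⊕ Bool), c.2)) ?_ _ _ h
  · cases b <;> exact this
  · rintro _ _ ⟨s, m, hB⟩
    exact Step.mk (M := ite A P Q) (.inl s) m hB

theorem run_ite_true (A P Q : Routine Γ K) {x : List Γ} {B : ℕ} {s : P.State} {m m' : Mem K}
    {b : Bool} (h : P.Run x B (.inl s, m) (.inr b, m')) :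
    (ite A P Q).Run x B (.inl (.inr (.inl s)), m) (.inr b, m') := by
  refine Relation.ReflTransGen.lift (p := (ite A P Q).Step x B)
    (fun c : (P.State ⊕ Bool) × Mem K =>
      (c.1.map (fun s' => .inr (.inl s')) id, c.2)) ?_ _ _ h
  rintro _ _ ⟨s, m, hB⟩
  exact Step.mk (M := ite A P Q) (.inr (.inl s)) m hB

theorem run_ite_false (A P Q : Routine Γ K) {x : List Γ} {B : ℕ} {s : Q.State} {m m' : Mem K}
    {b : Bool} (h : Q.Run x B (.inl s, m) (.inr b, m')) :
    (ite A P Q).Run x B (.inl (.inr (.inr s)), m) (.inr b, m') := by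
  refine Relation.ReflTransGen.lift (p := (ite A P Q).Step x B)
    (fun c : (Q.State ⊕ Bool) × Mem K =>
      (c.1.map (fun s' => .inr (.inr s')) id, c.2)) ?_ _ _ h
  rintro _ _ ⟨s, m, hB⟩
  exact Step.mk (M := ite A P Q) (.inr (.inr s)) m hB

theorem run_loop (A : Routine Γ K) {x : List Γ} {B : ℕ} {s : A.State} {m m' : Mem K}
    {b : Bool} (h : A.Run x B (.inl s, m) (.inr b, m')) :
    (loop A).Run x B (.inl s, m) (bif b then .inl A.start else .inr true, m') := by
  have := Relation.ReflTransGen.lift (p := (loop A).Step x B)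
    (fun c : (A.State ⊕ Bool) × Mem K => ((match c.1 with
        | .inl s' => .inl s'
        | .inr true => .inl A.start
        | .inr false => .inr true : (loop A).State ⊕ Bool), c.2)) ?_ _ _ h
  · cases b <;> exact this
  · rintro _ _ ⟨s, m, hB⟩
    exact Step.mk (M := loop A) s m hB

/-- The value of a list of binary digits, least significant digit first. -/
def bitsValue : List Bool → ℕ
  | [] => 0
  | b :: l => b.toNat + 2 * bitsValue l

/-- The tape content `t` has the digits `l` from cell `i` on, followed by blanks. -/
def HasDigits (t : ℕ → WorkSym) (i : ℕ) (l : List Bool) : Prop :=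
  ∀ j, t (i + j) = (l[j]?).elim .blank .bit

/-- A work tape in its rest position, with the number `v` on it: cell `0` is marked, the
binary digits of `v` start in cell `1`, and the head is on cell `1`. Leading zeros are
allowed, but the number of digits is bounded in terms of the bound `N` on all numbers. -/
structure HoldsNumber (N v i : ℕ) (t : ℕ → WorkSym) : Prop where
  head : i = 1
  mark : t 0 = .mark
  digits : ∃ l : List Bool, l.length ≤ Nat.log 2 N + 1 ∧ bitsValue l = v ∧ HasDigits t 1 l

/-- The input head is on cell `h`, and tape `t` holds the number `ρ t`. -/
structure Holds (N h : ℕ) (ρ : ℕ → ℕ) (m : Mem K) : Prop where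
  inputHead : m.inputHead = h
  head_le : h ≤ N + 1
  number : ∀ t : Fin K, HoldsNumber N (ρ t) (m.heads t) (m.tapes t)

/-- On input `x`, with the input head on cell `h` and the numbers `ρ` on the tapes, the routine
takes exit `b` with the input head on cell `h'` and the numbers `ρ'` on the tapes, and it uses
logarithmic space. -/
def Computes (M : Routine Γ K) (x : List Γ) (h : ℕ) (ρ : ℕ → ℕ) (b : Bool) (h' : ℕ) (ρ' : ℕ → ℕ) :
    Prop :=
  ∀ m : Mem K, Holds x.length h ρ m → ∃ m' : Mem K, Holds x.length h' ρ' m' ∧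
    M.Run x (Nat.log 2 x.length + 3) (.inl M.start, m) (.inr b, m')

variable {x : List Γ} {h h' h'' : ℕ} {ρ ρ' ρ'' : ℕ → ℕ} {b : Bool}

theorem Computes.ite_true {A P Q : Routine Γ K} (hA : A.Computes x h ρ true h' ρ')
    (hP : P.Computes x h' ρ' b h'' ρ'') : (ite A P Q).Computes x h ρ b h'' ρ'' := by
  intro m hm
  obtain ⟨m', hm', hr⟩ := hA m hm
  obtain ⟨m'', hm'', hr'⟩ := hP m' hm'
  exact ⟨m'', hm'', (run_ite_left A P Q hr).trans (run_ite_true A P Q hr')⟩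

theorem Computes.ite_false {A P Q : Routine Γ K} (hA : A.Computes x h ρ false h' ρ')
    (hQ : Q.Computes x h' ρ' b h'' ρ'') : (ite A P Q).Computes x h ρ b h'' ρ'' := by
  intro m hm
  obtain ⟨m', hm', hr⟩ := hA m hm
  obtain ⟨m'', hm'', hr'⟩ := hQ m' hm'
  exact ⟨m'', hm'', (run_ite_left A P Q hr).trans (run_ite_false A P Q hr')⟩

theorem Computes.loop_true {A : Routine Γ K} (hA : A.Computes x h ρ true h' ρ')
    (hL : (loop A).Computes x h' ρ' b h'' ρ'') : (loop A).Computes x h ρ b h'' ρ'' := by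
  intro m hm
  obtain ⟨m', hm', hr⟩ := hA m hm
  obtain ⟨m'', hm'', hr'⟩ := hL m' hm'
  exact ⟨m'', hm'', (run_loop A hr).trans hr'⟩

theorem Computes.loop_false {A : Routine Γ K} (hA : A.Computes x h ρ false h' ρ') :
    (loop A).Computes x h ρ true h' ρ' := by
  intro m hm
  obtain ⟨m', hm', hr⟩ := hA m hm
  exact ⟨m', hm', run_loop A hr⟩

theorem heads_lt_of_holds {N : ℕ} {m : Mem K} (hm : Holds N h ρ m) (t : Fin K) :
    m.heads t < Nat.log 2 N + 3 := by
  rw [(hm.number t).head]; omega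

theorem computes_basic (f : InputCell Γ → Bool × HeadMove) (x : List Γ) (h : ℕ) (ρ : ℕ → ℕ) :
    (basic f : Routine Γ K).Computes x h ρ (f (inputCell x h)).1
      (min ((f (inputCell x h)).2.apply h) (x.length + 1)) ρ := by
  intro m hm
  have h1 := Step.mk (M := (basic f : Routine Γ K)) (x := x) (B := Nat.log 2 x.length + 3) () m
    (heads_lt_of_holds hm)
  obtain ⟨rfl, _, hn⟩ := hm
  refine ⟨_, ⟨rfl, min_le_right _ _, fun t => ?_⟩, Relation.ReflTransGen.single h1⟩
  simpa [actOn, nextAt, basic, HeadMove.apply] using hn t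

end Routine

/-! ### Counting in binary on a work tape -/

namespace Routine

variable {Γ : Type} {K : ℕ}

/-- The routine that acts on the tape `v` only, with transition function `f`. -/
def onTape {S : Type} [Finite S] (v : Fin K) (s₀ : S)
    (f : S → WorkSym → (S ⊕ Bool) × WorkSym × HeadMove) : Routine Γ K where
  State := S
  finite_state := inferInstance
  start := s₀
  next := fun s _ w =>
    ((f s (w v)).1, .stay, fun t => if t = v then (f s (w v)).2 else (w t, .stay))

/-- One step of a transition function for one tape, with the head among the first `B` cells. -/
inductive TapeStep {S : Type} (f : S → WorkSym → (S ⊕ Bool) × WorkSym × HeadMove) (B : ℕ) :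
    (S ⊕ Bool) × ℕ × (ℕ → WorkSym) → (S ⊕ Bool) × ℕ × (ℕ → WorkSym) → Prop
  | mk (s : S) (i : ℕ) (T : ℕ → WorkSym) (hi : i < B) :
      TapeStep f B (.inl s, i, T)
        ((f s (T i)).1, (f s (T i)).2.2.apply i, Function.update T i (f s (T i)).2.1)

/-- Replacement of the head position and of the content of the tape `v`. -/
def putTape (m : Mem K) (v : Fin K) (i : ℕ) (T : ℕ → WorkSym) : Mem K where
  inputHead := m.inputHead
  heads := Function.update m.heads v i
  tapes := Function.update m.tapes v T

theorem run_onTape {S : Type} [Finite S] (v : Fin K) (s₀ : S)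
    (f : S → WorkSym → (S ⊕ Bool) × WorkSym × HeadMove) {x : List Γ} {B : ℕ} {m : Mem K}
    (hm : ∀ t, m.heads t < B) (hx : m.inputHead ≤ x.length + 1)
    {p q : (S ⊕ Bool) × ℕ × (ℕ → WorkSym)}
    (h : Relation.ReflTransGen (TapeStep f B) p q) :
    (onTape v s₀ f : Routine Γ K).Run x B (p.1, putTape m v p.2.1 p.2.2)
      (q.1, putTape m v q.2.1 q.2.2) := by
  refine Relation.ReflTransGen.lift (p := (onTape v s₀ f : Routine Γ K).Step x B)
    (fun c => (c.1, putTape m v c.2.1 c.2.2)) ?_ _ _ h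
  rintro _ _ ⟨s, i, T, hi⟩
  have hB : ∀ t, (putTape m v i T).heads t < B := by
    intro t
    by_cases ht : t = v
    · subst ht; simpa [putTape] using hi
    · simpa [putTape, ht] using hm t
  have := Step.mk (M := (onTape v s₀ f : Routine Γ K)) (x := x) s (putTape m v i T) hB
  refine cast (congrArg (Step (onTape v s₀ f : Routine Γ K) x B (.inl s, putTape m v i T)) ?_) this
  refine Prod.ext (by simp [nextAt, onTape, putTape]) ?_
  simp only [nextAt, onTape, actOn, putTape, Function.update_self, Mem.mk.injEq]
  refine ⟨by simp [HeadMove.apply, hx], ?_, ?_⟩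
  · funext t
    by_cases ht : t = v
    · subst ht; simp
    · simp [ht, HeadMove.apply]
  · funext t
    by_cases ht : t = v
    · subst ht; simp
    · simp [ht]

/-- The states of a routine for counting: it looks for the first digit that it has to change, or it
returns to the mark while setting digits, or it returns to the mark without any change. -/
inductive CountState : Type
  | scan : CountState
  | set : CountState
  | keep : CountState

instance : Finite CountState :=
  Finite.of_injective
    (fun s : CountState => match s with
      | .scan => (0 : Fin 3)
      | .set => 1
      | .keep => 2)
    (by rintro (_ | _ | _) (_ | _ | _) <;> simp)

/-- The transition function for adding one (`c = true`) or subtracting one (`c = false`): all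
digits `c` up to the first digit that differs from `c` are changed into the other digit, and that
one is changed into `c`. If there is no such digit, then addition puts a new digit, and
subtraction fails, as the number is `0`. -/
def countStep (c : Bool) : CountState → WorkSym → (CountState ⊕ Bool) × WorkSym × HeadMove
  | .scan, .bit b => bif b == c then (.inl .scan, .bit b, .right) else (.inl .set, .bit c, .left)
  | .scan, s => bif c then (.inl .set, .bit true, .left) else (.inl .keep, s, .left)
  | .set, .bit _ => (.inl .set, .bit !c, .left)
  | .set, s => (.inr true, s, .right)
  | .keep, .bit b => (.inl .keep, .bit b, .left)
  | .keep, s => (.inr false, s, .right)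

/-- Add one to the number on the tape `v`. -/
def inc (v : Fin K) : Routine Γ K := onTape v .scan (countStep true)

/-- Subtract one from the number on the tape `v`; leave with `false` if this number is `0`. -/
def dec (v : Fin K) : Routine Γ K := onTape v .scan (countStep false)

/-- A head that goes left to the mark and applies `g` to all digits on its way. -/
theorem tapeRun_return {S : Type} {f : S → WorkSym → (S ⊕ Bool) × WorkSym × HeadMove} {s : S}
    {b : Bool} {g : Bool → Bool} (hbit : ∀ c, f s (.bit c) = (.inl s, .bit (g c), .left))
    (hmark : f s .mark = (.inr b, .mark, .right)) {B : ℕ} (d : ℕ → Bool) :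
    ∀ (i : ℕ) (T : ℕ → WorkSym), i < B → T 0 = .mark →
      (∀ j, 1 ≤ j → j ≤ i → T j = .bit (d j)) →
      Relation.ReflTransGen (TapeStep f B) (.inl s, i, T)
        (.inr b, 1, fun j => if 1 ≤ j ∧ j ≤ i then .bit (g (d j)) else T j) := by
  intro i
  induction i with
  | zero =>
    intro T hB h0 _
    have h1 := TapeStep.mk (f := f) s 0 T hB
    rw [h0, hmark] at h1
    simp only [HeadMove.apply, zero_add] at h1
    refine Relation.ReflTransGen.single ?_
    convert h1 using 3
    funext j
    rcases Nat.eq_zero_or_pos j with rfl | hj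
    · simp [h0]
    · simp [hj.ne']
  | succ i ih =>
    intro T hB h0 hT
    have h1 := TapeStep.mk (f := f) s (i + 1) T hB
    rw [hT (i + 1) (by omega) le_rfl, hbit] at h1
    simp only [HeadMove.apply, Nat.add_sub_cancel] at h1
    refine Relation.ReflTransGen.head h1 ?_
    have h2 := ih (Function.update T (i + 1) (.bit (g (d (i + 1))))) (by omega) (by simp [h0])
      (fun j hj hji => by
        rw [Function.update_of_ne (by omega)]
        exact hT j hj (by omega))
    convert h2 using 3
    funext j
    rcases eq_or_ne j (i + 1) with rfl | hj
    · simp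
    · rw [Function.update_of_ne hj]
      congr 1
      exact propext ⟨fun h => ⟨h.1, by omega⟩, fun h => ⟨h.1, by omega⟩⟩

theorem tapeRun_scan {c : Bool} {B : ℕ} {T : ℕ → WorkSym} :
    ∀ (n i : ℕ), i + n ≤ B → (∀ j, j < n → T (i + j) = .bit c) →
      Relation.ReflTransGen (TapeStep (countStep c) B) (.inl .scan, i, T)
        (.inl .scan, i + n, T) := by
  intro n
  induction n with
  | zero => intro i _ _; exact Relation.ReflTransGen.refl
  | succ n ih =>
    intro i hB hT
    have h1 := TapeStep.mk (f := countStep c) .scan i T (show i < B by omega)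
    have hi : T i = .bit c := hT 0 (by omega)
    rw [hi] at h1
    simp only [countStep, BEq.rfl, cond_true, HeadMove.apply, ← hi, Function.update_eq_self] at h1
    refine Relation.ReflTransGen.head h1 ?_
    rw [show i + (n + 1) = i + 1 + n by omega]
    exact ih (i + 1) (by omega) fun j hj => by
      rw [show i + 1 + j = i + (j + 1) by omega]
      exact hT _ (by omega)

theorem exists_eq_replicate_append (c : Bool) (l : List Bool) :
    ∃ n r, l = List.replicate n c ++ r ∧ (r = [] ∨ ∃ r', r = (!c) :: r') := by
  induction l with
  | nil => exact ⟨0, [], rfl, .inl rfl⟩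
  | cons a l ih =>
    by_cases ha : a = c
    · obtain ⟨n, r, rfl, hr⟩ := ih
      exact ⟨n + 1, r, by rw [ha]; rfl, hr⟩
    · exact ⟨0, a :: l, rfl, .inr ⟨l, by rw [Bool.eq_not.2 ha]⟩⟩

theorem bitsValue_replicate_false (n : ℕ) : bitsValue (List.replicate n false) = 0 := by
  induction n with
  | zero => rfl
  | succ n ih => simp [List.replicate_succ, bitsValue, ih]

theorem bitsValue_carry (n : ℕ) (r : List Bool) :
    bitsValue (List.replicate n false ++ true :: r) =
      bitsValue (List.replicate n true ++ false :: r) + 1 := by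
  induction n with
  | zero => simp [bitsValue]; omega
  | succ n ih => simp [List.replicate_succ, bitsValue, ih]; omega

theorem bitsValue_carry_nil (n : ℕ) :
    bitsValue (List.replicate n false ++ [true]) = bitsValue (List.replicate n true) + 1 := by
  induction n with
  | zero => simp [bitsValue]
  | succ n ih => simp [List.replicate_succ, bitsValue, ih]; omega

theorem bitsValue_replicate_false_append_one (n : ℕ) :
    bitsValue (List.replicate n false ++ [true]) = 2 ^ n := by
  induction n with
  | zero => simp [bitsValue]
  | succ n ih => simp [List.replicate_succ, bitsValue, ih]; omega

/-- Counting changes the digits `c ⋯ c r` into `c̄ ⋯ c̄ c r'`, where `r'` is `r` without its first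
digit, if any. -/
theorem tapeRun_count {c : Bool} {B n : ℕ} {r : List Bool} {T : ℕ → WorkSym} (hB : n + 1 < B)
    (h0 : T 0 = .mark) (hT : HasDigits T 1 (List.replicate n c ++ r))
    (hr : (∃ r', r = (!c) :: r') ∨ (r = [] ∧ c = true)) :
    ∃ T' : ℕ → WorkSym, T' 0 = .mark ∧ HasDigits T' 1 (List.replicate n (!c) ++ c :: r.tail) ∧
      Relation.ReflTransGen (TapeStep (countStep c) B) (.inl .scan, 1, T) (.inr true, 1, T') := by
  have hlow : ∀ j, j < n → T (1 + j) = .bit c := fun j hj => by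
    rw [hT j, List.getElem?_append_left (by simpa using hj)]
    simp [hj]
  have h1 := tapeRun_scan (c := c) (B := B) n 1 (by omega) hlow
  have hn : T (1 + n) = r[0]?.elim .blank .bit := by
    rw [hT n, List.getElem?_append_right (by simp)]; simp
  have h2 := TapeStep.mk (f := countStep c) .scan (1 + n) T (show 1 + n < B by omega)
  have hstep : countStep c .scan (T (1 + n)) = (.inl .set, .bit c, .left) := by
    rcases hr with ⟨r', rfl⟩ | ⟨rfl, rfl⟩
    · rw [hn]; cases c <;> simp [countStep]
    · rw [hn]; simp [countStep]
  rw [hstep] at h2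
  have h3 := tapeRun_return (f := countStep c) (s := .set) (b := true) (g := fun _ => !c)
    (fun _ => rfl) rfl (B := B) (fun _ => c) n (Function.update T (1 + n) (.bit c)) (by omega)
    (by rw [Function.update_of_ne (by omega), h0]) (fun j hj hjn => by
      rw [Function.update_of_ne (by omega)]
      obtain ⟨k, rfl⟩ := Nat.exists_eq_add_of_le hj
      exact hlow k (by omega))
  simp only [HeadMove.apply, Nat.add_sub_cancel_left] at h2
  refine ⟨_, by simp [h0, Function.update_of_ne (show 0 ≠ 1 + n by omega)], fun j => ?_, (h1.tail h2).trans h3⟩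
  rcases lt_trichotomy j n with hj | rfl | hj
  · rw [if_pos ⟨by omega, by omega⟩, List.getElem?_append_left (by simpa using hj)]
    simp [hj]
  · rw [if_neg (by omega), Function.update_self, List.getElem?_append_right (by simp)]
    simp
  · obtain ⟨k, rfl⟩ := Nat.exists_eq_add_of_lt hj
    rw [if_neg (by omega), Function.update_of_ne (by omega), hT,
      List.getElem?_append_right (by simp; omega), List.getElem?_append_right (by simp; omega)]
    simp only [List.length_replicate, show n + k + 1 - n = k + 1 by omega,
      List.getElem?_cons_succ, List.getElem?_tail]

theorem tapeRun_count_zero {B n : ℕ} {T : ℕ → WorkSym} (hB : n + 1 < B)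
    (h0 : T 0 = .mark) (hT : HasDigits T 1 (List.replicate n false)) :
    Relation.ReflTransGen (TapeStep (countStep false) B) (.inl .scan, 1, T)
      (.inr false, 1, T) := by
  have hlow : ∀ j, j < n → T (1 + j) = .bit false := fun j hj => by
    rw [hT j]
    simp [hj]
  have h1 := tapeRun_scan (c := false) (B := B) n 1 (by omega) hlow
  have hn : T (1 + n) = .blank := by
    rw [hT n]; simp
  have h2 := TapeStep.mk (f := countStep false) .scan (1 + n) T (show 1 + n < B by omega)
  have hstep : countStep false .scan (T (1 + n)) = (.inl .keep, .blank, .left) := by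
    rw [hn]; rfl
  rw [hstep] at h2
  dsimp only at h2
  rw [← hn, Function.update_eq_self] at h2
  have h3 := tapeRun_return (f := countStep false) (s := .keep) (b := false) (g := id)
    (fun _ => rfl) rfl (B := B) (fun _ => false) n T (by omega) h0 (fun j hj hjn => by
      obtain ⟨k, rfl⟩ := Nat.exists_eq_add_of_le hj
      exact hlow k (by omega))
  refine (h1.tail h2).trans ?_
  simp only [HeadMove.apply, Nat.add_sub_cancel_left]
  convert h3 using 3
  funext j
  split_ifs with hj
  · obtain ⟨k, rfl⟩ := Nat.exists_eq_add_of_le hj.1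
    exact hlow k (by omega)
  · rfl

theorem computes_onTape {S : Type} [Finite S] {v : Fin K} {s₀ : S}
    {f : S → WorkSym → (S ⊕ Bool) × WorkSym × HeadMove} {x : List Γ} {h : ℕ} {ρ : ℕ → ℕ} {b : Bool}
    {k : ℕ}
    (H : ∀ T : ℕ → WorkSym, HoldsNumber x.length (ρ v) 1 T → ∃ T' : ℕ → WorkSym,
      HoldsNumber x.length k 1 T' ∧ Relation.ReflTransGen (TapeStep f (Nat.log 2 x.length + 3))
        (.inl s₀, 1, T) (.inr b, 1, T')) :
    (onTape v s₀ f : Routine Γ K).Computes x h ρ b h (Function.update ρ v k) := by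
  intro m hm
  have hv := hm.number v
  rw [hv.head] at hv
  obtain ⟨T', hT', hr⟩ := H _ hv
  refine ⟨putTape m v 1 T', ⟨hm.inputHead, hm.head_le, fun t => ?_⟩, ?_⟩
  · by_cases ht : t = v
    · subst ht
      simpa [putTape] using hT'
    · have : (t : ℕ) ≠ v := fun h => ht (Fin.ext h)
      simpa [putTape, ht, this] using hm.number t
  · have hrun := run_onTape (Γ := Γ) v s₀ f (heads_lt_of_holds hm) (hm.inputHead ▸ hm.head_le) hr
    have hput : putTape m v 1 (m.tapes v) = m := by
      have h1 := (hm.number v).head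
      cases m
      simp only [putTape, Mem.mk.injEq, Function.update_eq_self, true_and, and_true]
      rw [← h1, Function.update_eq_self]
    rw [hput] at hrun
    exact hrun

variable {x : List Γ} {h : ℕ} {ρ : ℕ → ℕ}

theorem computes_inc (v : Fin K) (hv : ρ v + 1 ≤ x.length) :
    (inc v : Routine Γ K).Computes x h ρ true h (Function.update ρ v (ρ v + 1)) := by
  refine computes_onTape fun T hT => ?_
  obtain ⟨-, h0, l, hl, hval, hdig⟩ := hT
  obtain ⟨n, r, rfl, hr⟩ := exists_eq_replicate_append true l
  rw [List.length_append, List.length_replicate] at hl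
  obtain ⟨T', h0', hT', hrun⟩ := tapeRun_count (B := Nat.log 2 x.length + 3) (by omega) h0 hdig
    (by rcases hr with h | h
        · exact .inr ⟨h, rfl⟩
        · exact .inl h)
  refine ⟨T', ⟨rfl, h0', _, ?_, ?_, hT'⟩, hrun⟩
  · rcases hr with rfl | ⟨r', rfl⟩
    · -- the number has a new digit only if it becomes the power `2 ^ n`
      have : 2 ^ n ≤ x.length := by
        rw [← bitsValue_replicate_false_append_one, bitsValue_carry_nil]
        rw [List.append_nil] at hval
        omega
      have := (Nat.le_log_iff_pow_le one_lt_two (by omega)).2 this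
      simpa using this
    · simpa using hl
  · rcases hr with rfl | ⟨r', rfl⟩
    · rw [← hval]
      simpa using bitsValue_carry_nil n
    · rw [← hval]
      exact bitsValue_carry n r'

theorem computes_dec_true (v : Fin K) (hv : ρ v ≠ 0) :
    (dec v : Routine Γ K).Computes x h ρ true h (Function.update ρ v (ρ v - 1)) := by
  refine computes_onTape fun T hT => ?_
  obtain ⟨-, h0, l, hl, hval, hdig⟩ := hT
  obtain ⟨n, r, rfl, hr⟩ := exists_eq_replicate_append false l
  rw [List.length_append, List.length_replicate] at hl
  rcases hr with rfl | ⟨r', rfl⟩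
  · rw [List.append_nil, bitsValue_replicate_false] at hval
    exact absurd hval.symm hv
  · obtain ⟨T', h0', hT', hrun⟩ := tapeRun_count (B := Nat.log 2 x.length + 3) (by omega) h0 hdig
      (.inl ⟨r', rfl⟩)
    refine ⟨T', ⟨rfl, h0', _, by simpa using hl, ?_, hT'⟩, hrun⟩
    rw [← hval]
    have := bitsValue_carry n r'
    simp only [Bool.not_false, List.tail_cons]
    omega

theorem computes_dec_false (v : Fin K) (hv : ρ v = 0) :
    (dec v : Routine Γ K).Computes x h ρ false h ρ := by
  have : (dec v : Routine Γ K).Computes x h ρ false h (Function.update ρ v (ρ v)) := by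
    refine computes_onTape fun T hT => ⟨T, hT, ?_⟩
    obtain ⟨-, h0, l, hl, hval, hdig⟩ := hT
    obtain ⟨n, r, rfl, hr⟩ := exists_eq_replicate_append false l
    rw [List.length_append, List.length_replicate] at hl
    rcases hr with rfl | ⟨r', rfl⟩
    · rw [List.append_nil] at hdig
      exact tapeRun_count_zero (by omega) h0 hdig
    · have := bitsValue_carry n r'
      simp only [Bool.not_false] at hval
      omega
  rwa [Function.update_eq_self] at this

end Routine

/-! ### Routines that move the input head and compare numbers -/

namespace Routine

variable {Γ : Type} {K : ℕ}

/-- Leave at once. -/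
def exit (b : Bool) : Routine Γ K := basic fun _ => (b, .stay)

/-- Run `A` and then `P`, whatever the exit of `A` is. -/
def seq (A P : Routine Γ K) : Routine Γ K := ite A P P

/-- Add the number on the tape `u` to the one on the tape `z`, put `0` on the tape `u`, and move the
input head once for each unit. -/
def drain (d : HeadMove) (u z : Fin K) : Routine Γ K :=
  loop (ite (dec u) (seq (inc z) (basic fun _ => (true, d))) (exit false))

/-- Move the input head to the right by the number on the tape `u`; the tape `z` is a
scratch tape. -/
def advance (z u : Fin K) : Routine Γ K := seq (drain .right u z) (drain .stay z u)

/-- Move the input head to the right by the sum of the numbers on the tapes in `l`. -/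
def advanceAll (z : Fin K) : List (Fin K) → Routine Γ K
  | [] => exit true
  | u :: l => seq (advance z u) (advanceAll z l)

/-- Move the input head to the right `k` times. -/
def moves : ℕ → Routine Γ K
  | 0 => exit true
  | k + 1 => seq (basic fun _ => (true, .right)) (moves k)

/-- Move the input head to the left end marker. -/
def home : Routine Γ K :=
  loop (basic fun c => match c with
    | .leftEnd => (false, .stay)
    | _ => (true, .left))

/-- Test the input cell whose position is `k` plus the sum of the numbers on the tapes in `l`. -/
def readCell (z : Fin K) (l : List (Fin K)) (k : ℕ) (C : InputCell Γ → Bool) : Routine Γ K :=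
  seq (advanceAll z l) (seq (moves k)
    (ite (basic fun c => (C c, .stay)) (seq home (exit true)) (seq home (exit false))))

/-- Subtract one from the numbers on the tapes `u` and `v`, and add one to the one on the tape `z`, as
long as this is possible. -/
def minLoop (z u v : Fin K) : Routine Γ K :=
  loop (ite (dec u) (ite (dec v) (inc z) (seq (inc u) (exit false))) (exit false))

/-- Add the number on the tape `z` to the ones on the tapes `u` and `v`, and put `0` on the
tape `z`. -/
def addBack (z u v : Fin K) : Routine Γ K :=
  loop (ite (dec z) (seq (inc u) (inc v)) (exit false))

/-- Test whether the number on the tape `u` is less than the one on the tape `v`. -/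
def less (z u v : Fin K) : Routine Γ K :=
  seq (minLoop z u v)
    (ite (dec v) (seq (inc v) (seq (addBack z u v) (exit true)))
      (seq (addBack z u v) (exit false)))

variable {x : List Γ} {h h' h'' : ℕ} {ρ ρ' ρ'' : ℕ → ℕ} {b b' : Bool}

theorem Computes.of_eq {A : Routine Γ K} {h₁ : ℕ} {ρ₁ : ℕ → ℕ} (hA : A.Computes x h ρ b h' ρ')
    (hh : h' = h₁) (hρ : ρ' = ρ₁) : A.Computes x h ρ b h₁ ρ₁ := hh ▸ hρ ▸ hA

theorem Computes.of_le {A : Routine Γ K}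
    (hA : h ≤ x.length + 1 → A.Computes x h ρ b h' ρ') : A.Computes x h ρ b h' ρ' :=
  fun m hm => hA hm.head_le m hm

theorem computes_exit (b : Bool) : (exit b : Routine Γ K).Computes x h ρ b h ρ :=
  .of_le fun hh => (computes_basic (fun _ => (b, .stay)) x h ρ).of_eq
    (by simpa [HeadMove.apply] using hh) rfl

theorem Computes.seq {A P : Routine Γ K} (hA : A.Computes x h ρ b h' ρ')
    (hP : P.Computes x h' ρ' b' h'' ρ'') : (seq A P).Computes x h ρ b' h'' ρ'' := by
  cases b
  · exact hA.ite_false hP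
  · exact hA.ite_true hP

theorem computes_drain (d : HeadMove) {u z : Fin K} (huz : (u : ℕ) ≠ z) :
    ∀ (n h : ℕ) (ρ : ℕ → ℕ), ρ u = n → ρ z + ρ u ≤ x.length →
      (drain d u z : Routine Γ K).Computes x h ρ true
        ((fun i => min (d.apply i) (x.length + 1))^[n] h)
        (Function.update (Function.update ρ u 0) z (ρ z + ρ u)) := by
  intro n
  induction n with
  | zero =>
    intro h ρ hn _
    refine ((computes_dec_false u hn).ite_false (computes_exit false)).loop_false.of_eq rfl ?_
    rw [hn, add_zero, ← hn, Function.update_eq_self, Function.update_eq_self]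
  | succ n ih =>
    intro h ρ hn hN
    have h1 := computes_dec_true (x := x) (h := h) (ρ := ρ) (Γ := Γ) u (by omega)
    have h2 := computes_inc (x := x) (h := h) (ρ := Function.update ρ u (ρ u - 1)) (Γ := Γ) z
      (by rw [Function.update_of_ne huz.symm]; omega)
    have h3 := (h1.ite_true (h2.seq (computes_basic (fun _ => (true, d)) x h _))
      (Q := exit false))
    refine h3.loop_true ((ih _ _ ?_ ?_).of_eq ?_ ?_)
    · rw [Function.update_of_ne huz, Function.update_self]; omega
    · rw [Function.update_self, Function.update_of_ne huz, Function.update_self,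
        Function.update_of_ne huz.symm]; omega
    · rw [Function.iterate_succ_apply]
    · funext t
      grind [Function.update_apply]

theorem iterate_right (n h N : ℕ) (hh : h ≤ N) :
    (fun i => min (HeadMove.right.apply i) N)^[n] h = min (h + n) N := by
  induction n generalizing h with
  | zero => simpa using hh
  | succ n ih =>
    rw [Function.iterate_succ_apply, ih _ (min_le_right _ _)]
    simp only [HeadMove.apply]
    omega

theorem iterate_stay (n h N : ℕ) (hh : h ≤ N) :
    (fun i => min (HeadMove.stay.apply i) N)^[n] h = h := by
  induction n with
  | zero => rfl
  | succ n ih => rw [Function.iterate_succ_apply', ih]; simpa [HeadMove.apply] using hh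

theorem computes_advance {u z : Fin K} (huz : (u : ℕ) ≠ z) (hz : ρ z = 0) (hu : ρ u ≤ x.length) :
    (advance z u : Routine Γ K).Computes x h ρ true (min (h + ρ u) (x.length + 1)) ρ := by
  refine .of_le fun hh => ?_
  refine (computes_drain .right huz _ h ρ rfl (by omega)).seq
    ((computes_drain .stay huz.symm _ _ _ rfl ?_).of_eq ?_ ?_)
  · grind [Function.update_apply]
  · rw [iterate_right _ _ _ hh, iterate_stay _ _ _ (min_le_right _ _)]
  · funext t
    grind [Function.update_apply]

theorem computes_advanceAll {z : Fin K} (hz : ρ z = 0) :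
    ∀ (l : List (Fin K)) (h : ℕ), (∀ u ∈ l, (u : ℕ) ≠ z ∧ ρ u ≤ x.length) →
    (advanceAll z l : Routine Γ K).Computes x h ρ true
      (min (h + (l.map fun u : Fin K => ρ u).sum) (x.length + 1)) ρ := by
  intro l
  induction l with
  | nil =>
    intro h _
    exact .of_le fun hh => (computes_exit true).of_eq (by simpa using hh) rfl
  | cons u l ih =>
    intro h hl
    have hu := hl u (by simp)
    refine (computes_advance hu.1 hz hu.2).seq
      ((ih _ fun v hv => hl v (List.mem_cons_of_mem _ hv)).of_eq ?_ rfl)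
    rw [List.map_cons, List.sum_cons]
    omega

theorem computes_moves (k : ℕ) : ∀ h, (moves k : Routine Γ K).Computes x h ρ true
    (min (h + k) (x.length + 1)) ρ := by
  induction k with
  | zero => exact fun h => .of_le fun hh => (computes_exit true).of_eq (by simpa using hh) rfl
  | succ k ih =>
    intro h
    refine (computes_basic _ x h ρ).seq ((ih _).of_eq ?_ rfl)
    simp only [HeadMove.apply]
    omega

theorem inputCell_succ_ne_leftEnd (i : ℕ) : inputCell x (i + 1) ≠ .leftEnd := by
  rw [inputCell]
  cases x[i]? <;> simp

theorem computes_home : ∀ h, (home : Routine Γ K).Computes x h ρ true 0 ρ := by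
  intro h
  induction h with
  | zero =>
    have := computes_basic (K := K) (fun c : InputCell Γ => match c with
      | .leftEnd => (false, HeadMove.stay)
      | _ => (true, .left)) x 0 ρ
    exact (this.of_eq rfl rfl).loop_false
  | succ h ih =>
    refine .of_le fun hh => ?_
    have := computes_basic (K := K) (fun c : InputCell Γ => match c with
      | .leftEnd => (false, HeadMove.stay)
      | _ => (true, .left)) x (h + 1) ρ
    have hne := inputCell_succ_ne_leftEnd (x := x) h
    cases hc : inputCell x (h + 1) with
    | leftEnd => exact absurd hc hne
    | letter a =>
      rw [hc] at this
      exact (this.of_eq (by simp only [HeadMove.apply]; omega) rfl).loop_true ih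
    | rightEnd =>
      rw [hc] at this
      exact (this.of_eq (by simp only [HeadMove.apply]; omega) rfl).loop_true ih

theorem inputCell_min (i : ℕ) : inputCell x (min i (x.length + 1)) = inputCell x i := by
  rcases le_total i (x.length + 1) with hi | hi
  · rw [min_eq_left hi]
  · rw [min_eq_right hi]
    obtain ⟨j, rfl⟩ : ∃ j, i = j + 1 := ⟨i - 1, by omega⟩
    simp only [inputCell]
    rw [List.getElem?_eq_none le_rfl, List.getElem?_eq_none (by omega)]

theorem computes_readCell {z : Fin K} (hz : ρ z = 0) {l : List (Fin K)}
    (hl : ∀ u ∈ l, (u : ℕ) ≠ z ∧ ρ u ≤ x.length) (k : ℕ) (C : InputCell Γ → Bool) :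
    (readCell z l k C).Computes x 0 ρ
      (C (inputCell x ((l.map fun u : Fin K => ρ u).sum + k))) 0 ρ := by
  have h1 := computes_advanceAll (Γ := Γ) (x := x) hz l 0 hl
  set S := (l.map fun u : Fin K => ρ u).sum
  have h2 := computes_moves (Γ := Γ) (x := x) (K := K) (ρ := ρ) k (min (0 + S) (x.length + 1))
  rw [show min (min (0 + S) (x.length + 1) + k) (x.length + 1) = min (S + k) (x.length + 1) by
    omega] at h2
  have h3 := computes_basic (K := K) (fun c => (C c, HeadMove.stay)) x
    (min (S + k) (x.length + 1)) ρ
  rw [inputCell_min] at h3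
  refine h1.seq (h2.seq ?_)
  cases hC : C (inputCell x (S + k))
  · rw [hC] at h3
    exact h3.ite_false ((computes_home _).seq (computes_exit false))
  · rw [hC] at h3
    exact h3.ite_true ((computes_home _).seq (computes_exit true))

theorem computes_minLoop {u v z : Fin K} (huv : (u : ℕ) ≠ v) (huz : (u : ℕ) ≠ z)
    (hvz : (v : ℕ) ≠ z) : ∀ (n : ℕ) (ρ : ℕ → ℕ), ρ u = n → ρ z + ρ u ≤ x.length →
      (minLoop z u v : Routine Γ K).Computes x h ρ true h
        (Function.update (Function.update (Function.update ρ u (ρ u - min (ρ u) (ρ v)))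
          v (ρ v - min (ρ u) (ρ v))) z (ρ z + min (ρ u) (ρ v))) := by
  intro n
  induction n with
  | zero =>
    intro ρ hn _
    refine ((computes_dec_false u hn).ite_false (computes_exit false)).loop_false.of_eq rfl ?_
    funext t
    grind [Function.update_apply]
  | succ n ih =>
    intro ρ hn hN
    have h1 := computes_dec_true (x := x) (h := h) (ρ := ρ) (Γ := Γ) u (by omega)
    rcases Nat.eq_zero_or_pos (ρ v) with hv | hv
    · have h2 := computes_dec_false (x := x) (h := h) (ρ := Function.update ρ u (ρ u - 1))
        (Γ := Γ) v (by rw [Function.update_of_ne huv.symm, hv])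
      have h3 := computes_inc (x := x) (h := h) (ρ := Function.update ρ u (ρ u - 1)) (Γ := Γ) u
        (by rw [Function.update_self]; omega)
      refine (h1.ite_true (h2.ite_false (h3.seq (computes_exit false)))).loop_false.of_eq rfl ?_
      funext t
      grind [Function.update_apply]
    · have h2 := computes_dec_true (x := x) (h := h) (ρ := Function.update ρ u (ρ u - 1))
        (Γ := Γ) v (by rw [Function.update_of_ne huv.symm]; omega)
      have h3 := computes_inc (x := x) (h := h) (Γ := Γ) z (ρ := Function.update
        (Function.update ρ u (ρ u - 1)) v (Function.update ρ u (ρ u - 1) v - 1))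
        (by grind [Function.update_apply])
      refine (h1.ite_true (h2.ite_true h3)).loop_true ((ih _ ?_ ?_).of_eq rfl ?_)
      · grind [Function.update_apply]
      · grind [Function.update_apply]
      · funext t
        grind [Function.update_apply]

theorem computes_addBack {u v z : Fin K} (huv : (u : ℕ) ≠ v) (huz : (u : ℕ) ≠ z)
    (hvz : (v : ℕ) ≠ z) : ∀ (n : ℕ) (ρ : ℕ → ℕ), ρ z = n → ρ u + ρ z ≤ x.length →
      ρ v + ρ z ≤ x.length →
      (addBack z u v : Routine Γ K).Computes x h ρ true h
        (Function.update (Function.update (Function.update ρ u (ρ u + ρ z))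
          v (ρ v + ρ z)) z 0) := by
  intro n
  induction n with
  | zero =>
    intro ρ hn _ _
    refine ((computes_dec_false z hn).ite_false (computes_exit false)).loop_false.of_eq rfl ?_
    funext t
    grind [Function.update_apply]
  | succ n ih =>
    intro ρ hn hu hv
    have h1 := computes_dec_true (x := x) (h := h) (ρ := ρ) (Γ := Γ) z (by omega)
    have h2 := computes_inc (x := x) (h := h) (ρ := Function.update ρ z (ρ z - 1)) (Γ := Γ) u
      (by grind [Function.update_apply])
    have h3 := computes_inc (x := x) (h := h) (Γ := Γ) v (ρ := Function.update
      (Function.update ρ z (ρ z - 1)) u (Function.update ρ z (ρ z - 1) u + 1))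
      (by grind [Function.update_apply])
    refine (h1.ite_true (h2.seq h3)).loop_true ((ih _ ?_ ?_ ?_).of_eq rfl ?_)
    · grind [Function.update_apply]
    · grind [Function.update_apply]
    · grind [Function.update_apply]
    · funext t
      grind [Function.update_apply]

theorem computes_less {u v z : Fin K} (huv : (u : ℕ) ≠ v) (huz : (u : ℕ) ≠ z)
    (hvz : (v : ℕ) ≠ z) (hz : ρ z = 0) (hu : ρ u ≤ x.length) (hv : ρ v ≤ x.length) :
    (less z u v : Routine Γ K).Computes x h ρ (decide (ρ u < ρ v)) h ρ := by
  refine (computes_minLoop huv huz hvz _ ρ rfl (by omega)).seq ?_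
  set σ : ℕ → ℕ := Function.update (Function.update (Function.update ρ u (ρ u - min (ρ u) (ρ v)))
          v (ρ v - min (ρ u) (ρ v))) z (ρ z + min (ρ u) (ρ v)) with hσ
  have hσu : σ u = ρ u - min (ρ u) (ρ v) := by grind [Function.update_apply]
  have hσv : σ v = ρ v - min (ρ u) (ρ v) := by grind [Function.update_apply]
  have hσz : σ z = min (ρ u) (ρ v) := by grind [Function.update_apply]
  have h1 := computes_addBack (Γ := Γ) (x := x) (h := h) huv huz hvz _ σ rfl (by omega) (by omega)
  have hback : Function.update (Function.update (Function.update σ u (σ u + σ z))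
      v (σ v + σ z)) z 0 = ρ := by
    funext t
    grind [Function.update_apply]
  rw [hback] at h1
  by_cases hlt : ρ u < ρ v
  · rw [decide_eq_true hlt]
    refine (computes_dec_true v (by omega)).ite_true (.seq ((computes_inc v ?_).of_eq rfl ?_)
      (h1.seq (computes_exit true)))
    · rw [Function.update_self]; omega
    · rw [Function.update_self, Function.update_idem]
      rw [show σ v - 1 + 1 = σ v by omega, Function.update_eq_self]
  · rw [decide_eq_false hlt]
    exact (computes_dec_false v (by omega)).ite_false (h1.seq (computes_exit false))

end Routine

/-! ### Predicates decidable in logarithmic space -/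

namespace Routine

variable {Γ : Type} {K : ℕ}

/-- The machine that marks cell `0` of all work tapes and then runs the routine `M`, with the exits
of `M` as its halting states. -/
def toOfflineTM (M : Routine Γ K) : OfflineTM Γ where
  State := Option (M.State ⊕ Bool)
  finite_state := by
    have := M.finite_state
    infer_instance
  Work := WorkSym
  finite_work := inferInstance
  blank := .blank
  tapes := K
  start := none
  accept := {some (.inr true)}
  trans
    | none, _, _ => some (some (.inl M.start), .stay, fun _ => (.mark, .right))
    | some (.inl s), c, w => some (some (M.next s c w).1, (M.next s c w).2)
    | some (.inr _), _, _ => none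

/-- The configuration of the machine that belongs to a configuration of the routine. -/
def toCfg (M : Routine Γ K) (p : (M.State ⊕ Bool) × Mem K) : M.toOfflineTM.Cfg where
  state := some p.1
  inputHead := p.2.inputHead
  workHead := p.2.heads
  work := p.2.tapes

/-- As the computation is deterministic, a property of the configurations on a path to a halting
configuration is a property of all reachable configurations. -/
theorem eval_of_reflTransGen {σ : Type*} {f : σ → Option σ} {G : σ → Prop} {a e : σ}
    (h : Relation.ReflTransGen (fun a b => b ∈ f a ∧ G a) a e) (hG : G e) (he : f e = none) :
    e ∈ StateTransition.eval f a ∧ ∀ c, StateTransition.Reaches f a c → G c := by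
  refine ⟨StateTransition.mem_eval.2 ⟨Relation.ReflTransGen.mono (fun _ _ h => h.1) _ _ h, he⟩, ?_⟩
  induction h using Relation.ReflTransGen.head_induction_on with
  | refl =>
    intro c hc
    rcases Relation.ReflTransGen.cases_head hc with rfl | ⟨d, hd, -⟩
    · exact hG
    · rw [he] at hd; cases hd
  | head h _ ih =>
    intro c hc
    rcases Relation.ReflTransGen.cases_head hc with rfl | ⟨d, hd, hdc⟩
    · exact h.2
    · exact ih c (Option.mem_unique hd h.1 ▸ hdc)

/-- A predicate of words and environments (numbers for the variables `0, 1, 2, …`) is decidable in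
logarithmic space, with `K` tapes for the variables and one scratch tape, if a routine decides it and
leaves the environment as it was, provided that the numbers are bounded by the length of the word and
that the variables from `f` on have value `0`. So the variables below `f` are the free ones, and the
routine may use the others for its quantifiers. -/
def LogDecidable (K f : ℕ) (R : List Γ → (ℕ → ℕ) → Prop) : Prop :=
  ∃ M : Routine Γ (K + 1), ∀ (x : List Γ) (ρ : ℕ → ℕ) (b : Bool), (∀ i, ρ i ≤ x.length) →
    (∀ i, f ≤ i → ρ i = 0) → (b = true ↔ R x ρ) → M.Computes x 0 ρ b 0 ρ

theorem LogDecidable.inLOGSPACE [Finite Γ] {R : List Γ → (ℕ → ℕ) → Prop}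
    (hR : LogDecidable K 0 R) : InLOGSPACE {x : List Γ | R x fun _ => 0} := by
  classical
  obtain ⟨M, hM⟩ := hR
  have key : ∀ x : List Γ, ∃ e : M.toOfflineTM.Cfg,
      e.state = some (.inr (decide (R x fun _ => 0))) ∧
      e ∈ StateTransition.eval (M.toOfflineTM.step x) M.toOfflineTM.init ∧
      ∀ c, StateTransition.Reaches (M.toOfflineTM.step x) M.toOfflineTM.init c →
        ∀ t, c.workHead t < Nat.log 2 x.length + 3 := by
    intro x
    let m : Mem (K + 1) := ⟨0, fun _ => 1, fun _ => Function.update (fun _ => .blank) 0 .mark⟩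
    have hm : Holds x.length 0 (fun _ => 0) m :=
      ⟨rfl, Nat.zero_le _, fun t => ⟨rfl, by simp [m], [], Nat.zero_le _, rfl, fun j => by
        simp [m]⟩⟩
    obtain ⟨m', hm', hr⟩ := hM x (fun _ => 0) (decide (R x fun _ => 0)) (fun _ => Nat.zero_le _)
      (fun _ _ => rfl) decide_eq_true_iff m hm
    refine ⟨M.toCfg (.inr (decide (R x fun _ => 0)), m'), rfl, ?_⟩
    refine eval_of_reflTransGen (G := fun c : M.toOfflineTM.Cfg =>
      ∀ t, c.workHead t < Nat.log 2 x.length + 3) ?_ (heads_lt_of_holds hm') rfl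
    have h1 : M.toOfflineTM.step x M.toOfflineTM.init = some (M.toCfg (.inl M.start, m)) := by
      simp only [OfflineTM.step, OfflineTM.init, toOfflineTM, toCfg, HeadMove.apply, m,
        Option.map_some, Nat.zero_min, zero_add]
    refine Relation.ReflTransGen.head ⟨h1, fun t => ?_⟩ ?_
    · simp [OfflineTM.init]
    · refine Relation.ReflTransGen.lift M.toCfg ?_ _ _ hr
      rintro _ _ ⟨s, m, hB⟩
      exact ⟨rfl, hB⟩
  refine ⟨M.toOfflineTM, fun x => ?_, 3, fun x c hc t => ?_⟩
  · obtain ⟨e, he, hmem, -⟩ := key x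
    refine ⟨Part.dom_iff_mem.2 ⟨e, hmem⟩, ?_⟩
    have hacc : e.state ∈ M.toOfflineTM.accept ↔ R x fun _ => 0 := by
      rw [he]
      change some (Sum.inr _) ∈ ({some (.inr true)} : Set (Option (M.State ⊕ Bool))) ↔ _
      simp
    refine Iff.trans ⟨fun ⟨c, hc, hc'⟩ => ?_, fun h => ⟨e, hmem, h⟩⟩ hacc
    rwa [← Part.mem_unique hc hmem]
  · obtain ⟨-, -, -, h⟩ := key x
    have := h c hc t
    omega

/-- The letter in an input cell, if there is one. -/
def _root_.InputCell.letter? : InputCell Γ → Option Γ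
  | .letter a => some a
  | _ => none

theorem letter?_inputCell_succ (x : List Γ) (i : ℕ) : (inputCell x (i + 1)).letter? = x[i]? := by
  rw [inputCell]
  cases x[i]? <;> rfl

namespace LogDecidable

variable {f : ℕ} {R S : List Γ → (ℕ → ℕ) → Prop}

theorem congr (hR : LogDecidable K f R) (h : ∀ x ρ, R x ρ ↔ S x ρ) : LogDecidable K f S := by
  obtain ⟨M, hM⟩ := hR
  exact ⟨M, fun x ρ b hρ hf hb => hM x ρ b hρ hf (hb.trans (h x ρ).symm)⟩

theorem true : LogDecidable K f fun (_ : List Γ) _ => True :=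
  ⟨exit .true, fun x ρ b _ _ hb => by
    rw [hb.2 trivial]
    exact computes_exit .true⟩

theorem not (hR : LogDecidable K f R) : LogDecidable K f fun x ρ => ¬ R x ρ := by
  obtain ⟨M, hM⟩ := hR
  refine ⟨ite M (exit false) (exit .true), fun x ρ b hρ hf hb => ?_⟩
  cases b
  · exact (hM x ρ .true hρ hf (by simpa using hb)).ite_true (computes_exit _)
  · exact (hM x ρ false hρ hf (by simpa using hb)).ite_false (computes_exit _)

theorem and (hR : LogDecidable K f R) (hS : LogDecidable K f S) :
    LogDecidable K f fun x ρ => R x ρ ∧ S x ρ := by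
  obtain ⟨M, hM⟩ := hR
  obtain ⟨P, hP⟩ := hS
  refine ⟨ite M P (exit false), fun x ρ b hρ hf hb => ?_⟩
  by_cases h : R x ρ
  · exact (hM x ρ .true hρ hf (by simpa using h)).ite_true (hP x ρ b hρ hf (by simpa [h] using hb))
  · have hb' : b = false := by simpa [h] using hb
    rw [hb']
    exact (hM x ρ false hρ hf (by simpa using h)).ite_false (computes_exit _)

theorem imp (hR : LogDecidable K f R) (hS : LogDecidable K f S) :
    LogDecidable K f fun x ρ => R x ρ → S x ρ :=
  (hR.and hS.not).not.congr fun x ρ => by tauto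

theorem iff (hR : LogDecidable K f R) (hS : LogDecidable K f S) :
    LogDecidable K f fun x ρ => R x ρ ↔ S x ρ :=
  ((hR.imp hS).and (hS.imp hR)).congr fun x ρ => by tauto

theorem forall_finite {ι : Type*} [Finite ι] {R : ι → List Γ → (ℕ → ℕ) → Prop}
    (hR : ∀ i, LogDecidable K f (R i)) : LogDecidable K f fun x ρ => ∀ i, R i x ρ := by
  classical
  have := Fintype.ofFinite ι
  suffices ∀ s : Finset ι, LogDecidable K f fun x ρ => ∀ i ∈ s, R i x ρ from
    (this Finset.univ).congr fun x ρ => by simp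
  intro s
  induction s using Finset.induction_on with
  | empty => exact LogDecidable.true.congr fun x ρ => by simp
  | insert i s _ ih => exact ((hR i).and ih).congr fun x ρ => by simp

/-- Bounded quantification: the routine counts the new variable upwards until the predicate
fails or the end of the input is reached; as this count ends in a moment when the predicate has been
evaluated, it suffices to evaluate it once more. -/
theorem all (hf : f < K) (hR : LogDecidable K (f + 1) R) :
    LogDecidable K f fun x ρ => ∀ y ≤ x.length, R x (Function.update ρ f y) := by
  classical
  obtain ⟨M, hM⟩ := hR
  let v : Fin (K + 1) := ⟨f, by omega⟩
  let z : Fin (K + 1) := Fin.last K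
  let count : Routine Γ (K + 1) :=
    loop (ite M (ite (readCell z [v] 1 fun c => decide (c.letter? = none)) (exit false) (inc v))
      (exit false))
  let reset : Routine Γ (K + 1) := loop (dec v)
  refine ⟨seq count (ite M (seq reset (exit .true)) (seq reset (exit false))),
    fun x ρ b hρ hfρ hb => ?_⟩
  have hM' : ∀ y ≤ x.length, M.Computes x 0 (Function.update ρ f y)
      (decide (R x (Function.update ρ f y))) 0 (Function.update ρ f y) := by
    intro y hy
    refine hM x _ _ (fun i => ?_) (fun i hi => ?_) decide_eq_true_iff
    · by_cases h : i = f
      · rw [h, Function.update_self]; exact hy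
      · rw [Function.update_of_ne h]; exact hρ i
    · rw [Function.update_of_ne (by omega)]
      exact hfρ i (by omega)
  have hreset : ∀ y, reset.Computes x 0 (Function.update ρ f y) .true 0 ρ := by
    intro y
    induction y with
    | zero =>
      have h0 : Function.update ρ f 0 = ρ := by
        rw [← hfρ f le_rfl, Function.update_eq_self]
      rw [h0]
      exact (computes_dec_false v (hfρ f le_rfl)).loop_false
    | succ y ih =>
      refine .loop_true ((computes_dec_true v ?_).of_eq rfl ?_) ih
      · simp [v]
      · simp [v]
  have hcount : ∀ n y, y + n = x.length → ∃ y', y ≤ y' ∧ y' ≤ x.length ∧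
      (∀ w, y ≤ w → w < y' → R x (Function.update ρ f w)) ∧
      (y' = x.length ∨ ¬ R x (Function.update ρ f y')) ∧
      count.Computes x 0 (Function.update ρ f y) .true 0 (Function.update ρ f y') := by
    intro n
    induction n with
    | zero =>
      intro y hy
      have hend := computes_readCell (Γ := Γ) (x := x) (ρ := Function.update ρ f y) (z := z)
        (by simp only [z, Fin.val_last]; rw [Function.update_of_ne (by omega), hfρ _ (by omega)])
        (l := [v]) (by simp [v, z]; omega) 1 (fun c => decide (c.letter? = none))
      rw [letter?_inputCell_succ] at hend
      refine ⟨y, le_rfl, by omega, fun w _ _ => by omega, .inl hy, Computes.loop_false ?_⟩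
      have h1 := hM' y (by omega)
      by_cases h : R x (Function.update ρ f y)
      · rw [decide_eq_true h] at h1
        refine h1.ite_true (Computes.ite_true ?_ (computes_exit _))
        simpa [v, show x.length ≤ y by omega] using hend
      · rw [decide_eq_false h] at h1
        exact h1.ite_false (computes_exit _)
    | succ n ih =>
      intro y hy
      have h1 := hM' y (by omega)
      by_cases h : R x (Function.update ρ f y)
      · have hend := computes_readCell (Γ := Γ) (x := x) (ρ := Function.update ρ f y) (z := z)
          (by simp only [z, Fin.val_last]; rw [Function.update_of_ne (by omega), hfρ _ (by omega)])
          (l := [v]) (by simp [v, z]; omega) 1 (fun c => decide (c.letter? = none))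
        rw [letter?_inputCell_succ] at hend
        rw [decide_eq_true h] at h1
        obtain ⟨y', hyy', hy', hw, hor, hc⟩ := ih (y + 1) (by omega)
        refine ⟨y', by omega, hy', fun w hyw hwy => ?_, hor, Computes.loop_true (h1.ite_true
          (Computes.ite_false ?_ ((computes_inc (ρ := Function.update ρ f y) v ?_).of_eq rfl ?_))) hc⟩
        · rcases hyw.eq_or_lt with rfl | hlt
          · exact h
          · exact hw w hlt hwy
        · simpa [v, show y < x.length by omega] using hend
        · simp only [v, Function.update_self]; omega
        · simp [v]
      · rw [decide_eq_false h] at h1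
        exact ⟨y, le_rfl, by omega, fun w _ _ => by omega, .inr h,
          Computes.loop_false (h1.ite_false (computes_exit _))⟩
  obtain ⟨y, -, hy, hw, hor, hc⟩ := hcount x.length 0 (zero_add _)
  have h0 : Function.update ρ f 0 = ρ := by
    rw [← hfρ f le_rfl, Function.update_eq_self]
  rw [h0] at hc
  refine hc.seq ?_
  have h1 := hM' y hy
  by_cases h : R x (Function.update ρ f y)
  · have hy' : y = x.length := hor.resolve_right (not_not_intro h)
    have hb' : b = Bool.true := hb.2 fun w hwx => by
      rcases hwx.eq_or_lt with rfl | hlt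
      · rw [← hy']; exact h
      · exact hw w (Nat.zero_le _) (by omega)
    rw [decide_eq_true h] at h1
    rw [hb']
    exact h1.ite_true ((hreset y).seq (computes_exit _))
  · have hb' : b = false := by
      rw [← Bool.not_eq_true, hb]
      exact fun h' => h (h' y hy)
    rw [decide_eq_false h] at h1
    rw [hb']
    exact h1.ite_false ((hreset y).seq (computes_exit _))

theorem ex (hf : f < K) (hR : LogDecidable K (f + 1) R) :
    LogDecidable K f fun x ρ => ∃ y ≤ x.length, R x (Function.update ρ f y) :=
  (hR.not.all hf).not.congr fun x ρ => by push Not; rfl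

theorem lt {u v : ℕ} (hf : f ≤ K) (hu : u < f) (hv : v < f) :
    LogDecidable K f fun (_ : List Γ) ρ => ρ u < ρ v := by
  rcases eq_or_ne u v with rfl | huv
  · exact LogDecidable.true.not.congr fun x ρ => by simp
  refine ⟨less (Fin.last K) ⟨u, by omega⟩ ⟨v, by omega⟩, fun x ρ b hρ hfρ hb => ?_⟩
  have hb' : b = decide (ρ u < ρ v) := by rw [Bool.eq_iff_iff, hb, decide_eq_true_iff]
  rw [hb']
  exact computes_less (by simpa using huv) (by simp; omega) (by simp; omega)
    (hfρ _ (by simpa using hf)) (hρ _) (hρ _)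

theorem letter (hf : f ≤ K) {u : ℕ} (hu : u < f) (c : Option Γ) :
    LogDecidable K f fun x ρ => x[ρ u]? = c := by
  classical
  refine ⟨readCell (Fin.last K) [⟨u, by omega⟩] 1 fun d => decide (d.letter? = c),
    fun x ρ b hρ hfρ hb => ?_⟩
  have hb' : b = decide (x[ρ u]? = c) := by rw [Bool.eq_iff_iff, hb, decide_eq_true_iff]
  rw [hb', ← letter?_inputCell_succ]
  have := computes_readCell (x := x) (z := Fin.last K) (hfρ K hf)
    (l := [⟨u, by omega⟩]) (by simp [hρ]; omega) 1 fun d => decide (d.letter? = c)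
  simpa using this

/-- The letter at an offset behind another position; the predecessor of that position is `ρ u`. -/
theorem letter_add (hf : f ≤ K) {u v : ℕ} (hu : u < f) (hv : v < f) (c : Option Γ) :
    LogDecidable K f fun x ρ => x[ρ u + ρ v + 1]? = c := by
  classical
  refine ⟨readCell (Fin.last K) [⟨u, by omega⟩, ⟨v, by omega⟩] 2 fun d => decide (d.letter? = c),
    fun x ρ b hρ hfρ hb => ?_⟩
  have hb' : b = decide (x[ρ u + ρ v + 1]? = c) := by rw [Bool.eq_iff_iff, hb, decide_eq_true_iff]
  rw [hb', ← letter?_inputCell_succ]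
  have := computes_readCell (x := x) (z := Fin.last K) (hfρ K hf)
    (l := [⟨u, by omega⟩, ⟨v, by omega⟩]) (by simp [hρ]; omega) 2 fun d => decide (d.letter? = c)
  simpa using this

end LogDecidable

end Routine

/-! ### Commuting idempotents, read off the encoding of a DFA -/

namespace DFAEncoding

open Computability Routine

/-- Position `b` of `x` holds an opening bracket other than the first one. In the encoding of
a DFA the first opening bracket belongs to the list of accepting states, and all others belong to
transitions. -/
def IsItem (x : List Γ') (b : ℕ) : Prop :=
  x[b]? = some .bra ∧ ∃ y ≤ x.length, x[y]? = some .bra ∧ y < b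

/-- Position `e` of `x` holds the first comma behind position `r`. -/
def NextComma (x : List Γ') (r e : ℕ) : Prop :=
  r < e ∧ x[e]? = some .comma ∧ ∀ y ≤ x.length, r < y → y < e → x[y]? ≠ some .comma

/-- The `i`-th number (`i = 0, 1, …`) behind position `b` of `x` starts behind position `r`. -/
def FieldStart (x : List Γ') : ℕ → ℕ → ℕ → Prop
  | 0, b, r => b = r
  | i + 1, b, r => ∃ y ≤ x.length, FieldStart x i b y ∧ NextComma x y r

/-- The letters behind the positions `r` and `t` agree up to the first comma behind `r`
inclusive. -/
def SameNumber (x : List Γ') (r t : ℕ) : Prop :=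
  ∀ d ≤ x.length, (∀ e ≤ x.length, e < d → x[r + e + 1]? ≠ some .comma) →
    ∀ c : Γ', x[r + d + 1]? = some c ↔ x[t + d + 1]? = some c

/-- The `i`-th number behind position `b` is the `j`-th number behind position `c`. -/
def SameField (x : List Γ') (i b j c : ℕ) : Prop :=
  ∀ r ≤ x.length, ∀ t ≤ x.length, FieldStart x i b r → FieldStart x j c t → SameNumber x r t

/-- The conditions that the letters act as commuting idempotents, in terms of positions of
transitions in the encoding. -/
def CommutingIdempotents (x : List Γ') : Prop :=
  (∀ b ≤ x.length, ∀ c ≤ x.length, IsItem x b → IsItem x c →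
    SameField x 2 b 0 c → SameField x 1 b 1 c → SameField x 2 b 2 c) ∧
  ∀ b ≤ x.length, ∀ c ≤ x.length, ∀ b' ≤ x.length, ∀ c' ≤ x.length,
    IsItem x b → IsItem x c → IsItem x b' → IsItem x c' →
    SameField x 0 b 0 c → SameField x 2 b 0 b' → SameField x 1 c 1 b' →
    SameField x 2 c 0 c' → SameField x 1 b 1 c' → SameField x 2 b' 2 c'

variable {K f : ℕ}

theorem logDecidable_isItem (hf : f + 1 ≤ K) {u : ℕ} (hu : u < f) :
    LogDecidable K f fun x ρ => IsItem x (ρ u) := by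
  refine ((LogDecidable.letter (by omega) hu (some .bra)).and (LogDecidable.ex (by omega)
    ((LogDecidable.letter hf (Nat.lt_succ_self f) (some .bra)).and
      (LogDecidable.lt hf (Nat.lt_succ_self f) (show u < f + 1 by omega))))).congr fun x ρ => ?_
  simp [IsItem, hu.ne]

theorem logDecidable_nextComma (hf : f + 1 ≤ K) {u v : ℕ} (hu : u < f) (hv : v < f) :
    LogDecidable K f fun x ρ => NextComma x (ρ u) (ρ v) := by
  refine ((LogDecidable.lt (by omega) hu hv).and
    ((LogDecidable.letter (by omega) hv (some .comma)).and (LogDecidable.all (by omega)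
    ((LogDecidable.lt hf (show u < f + 1 by omega) (Nat.lt_succ_self f)).imp
      ((LogDecidable.lt hf (Nat.lt_succ_self f) (show v < f + 1 by omega)).imp
      (LogDecidable.letter hf (Nat.lt_succ_self f) (some .comma)).not))))).congr fun x ρ => ?_
  simp [NextComma, hu.ne, hv.ne]

theorem logDecidable_fieldStart (i : ℕ) {f : ℕ} (hf : f + i + 1 ≤ K) {u v : ℕ} (hu : u < f)
    (hv : v < f) : LogDecidable K f fun x ρ => FieldStart x i (ρ u) (ρ v) := by
  induction i generalizing f v with
  | zero =>
    refine ((LogDecidable.lt (by omega) hu hv).not.and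
      (LogDecidable.lt (by omega) hv hu).not).congr fun x ρ => ?_
    rw [FieldStart]
    omega
  | succ i ih =>
    refine (LogDecidable.ex (by omega) ((ih (by omega) (show u < f + 1 by omega)
      (Nat.lt_succ_self f)).and (logDecidable_nextComma (by omega) (Nat.lt_succ_self f)
      (show v < f + 1 by omega)))).congr fun x ρ => ?_
    simp [FieldStart, hu.ne, hv.ne]

theorem logDecidable_sameNumber (hf : f + 2 ≤ K) {u v : ℕ} (hu : u < f) (hv : v < f) :
    LogDecidable K f fun x ρ => SameNumber x (ρ u) (ρ v) := by
  refine (LogDecidable.all (by omega) ((LogDecidable.all (by omega)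
    ((LogDecidable.lt hf (Nat.lt_succ_self (f + 1)) (show f < f + 2 by omega)).imp
      (LogDecidable.letter_add hf (show u < f + 2 by omega) (Nat.lt_succ_self (f + 1))
        (some .comma)).not)).imp
    (LogDecidable.forall_finite fun c : Γ' =>
      (LogDecidable.letter_add (by omega) (show u < f + 1 by omega) (Nat.lt_succ_self f)
        (some c)).iff
      (LogDecidable.letter_add (by omega) (show v < f + 1 by omega) (Nat.lt_succ_self f)
        (some c))))).congr fun x ρ => ?_
  simp [SameNumber, hu.ne, hv.ne, (show u ≠ f + 1 by omega)]

theorem logDecidable_sameField (i j : ℕ) (hf : f + i + j + 5 ≤ K) {u v : ℕ} (hu : u < f)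
    (hv : v < f) : LogDecidable K f fun x ρ => SameField x i (ρ u) j (ρ v) := by
  refine (LogDecidable.all (by omega) (LogDecidable.all (by omega)
    ((logDecidable_fieldStart i (by omega) (show u < f + 2 by omega)
      (show f < f + 2 by omega)).imp
    ((logDecidable_fieldStart j (by omega) (show v < f + 2 by omega)
      (Nat.lt_succ_self (f + 1))).imp
    (logDecidable_sameNumber (by omega) (show f < f + 2 by omega)
      (Nat.lt_succ_self (f + 1))))))).congr fun x ρ => ?_
  simp [SameField, hu.ne, hv.ne, (show u ≠ f + 1 by omega), (show v ≠ f + 1 by omega)]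

/-- Nine variables are in use at the same time at most; `16` meets the bounds of the lemmas above. -/
theorem logDecidable_commutingIdempotents :
    LogDecidable 16 0 fun x _ => CommutingIdempotents x := by
  have item : ∀ {f u : ℕ}, f ≤ 4 → u < f → LogDecidable 16 f fun x ρ => IsItem x (ρ u) :=
    fun hf hu => logDecidable_isItem (by omega) hu
  have same : ∀ {f u v : ℕ} (i j : ℕ), f + i + j ≤ 8 → u < f → v < f →
      LogDecidable 16 f fun x ρ => SameField x i (ρ u) j (ρ v) :=
    fun i j hf hu hv => logDecidable_sameField i j (by omega) hu hv
  refine ((LogDecidable.all (by omega) (LogDecidable.all (by omega)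
    ((item (f := 2) (u := 0) (by omega) (by omega)).imp
    ((item (u := 1) (by omega) (by omega)).imp
    ((same (u := 0) (v := 1) 2 0 (by omega) (by omega) (by omega)).imp
    ((same (u := 0) (v := 1) 1 1 (by omega) (by omega) (by omega)).imp
    (same (u := 0) (v := 1) 2 2 (by omega) (by omega) (by omega)))))))).and
    (LogDecidable.all (by omega) (LogDecidable.all (by omega)
    (LogDecidable.all (by omega) (LogDecidable.all (by omega)
    ((item (f := 4) (u := 0) (by omega) (by omega)).imp
    ((item (u := 1) (by omega) (by omega)).imp
    ((item (u := 2) (by omega) (by omega)).imp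
    ((item (u := 3) (by omega) (by omega)).imp
    ((same (u := 0) (v := 1) 0 0 (by omega) (by omega) (by omega)).imp
    ((same (u := 0) (v := 2) 2 0 (by omega) (by omega) (by omega)).imp
    ((same (u := 1) (v := 2) 1 1 (by omega) (by omega) (by omega)).imp
    ((same (u := 1) (v := 3) 2 0 (by omega) (by omega) (by omega)).imp
    ((same (u := 0) (v := 3) 1 1 (by omega) (by omega) (by omega)).imp
    (same (u := 2) (v := 3) 2 2 (by omega) (by omega) (by omega)))))))))))))))).congr
    fun x ρ => ?_
  simp [CommutingIdempotents]

theorem getElem?_of_drop {x : List Γ'} {r : ℕ} {l : List Γ'} (h : x.drop (r + 1) = l) (j : ℕ) :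
    x[r + j + 1]? = l[j]? := by
  rw [← h, List.getElem?_drop]
  congr 1
  omega

theorem encodeNumber_getElem?_length (k : ℕ) (s : List Γ') :
    (encodeNumber k ++ s)[(Nat.bits k).length]? = some .comma := by
  simp [encodeNumber]

theorem encodeNumber_getElem?_of_lt {k : ℕ} (s : List Γ') {j : ℕ} (hj : j < (Nat.bits k).length) :
    (encodeNumber k ++ s)[j]? = some (.bit (Nat.bits k)[j]) := by
  rw [encodeNumber, List.append_assoc, List.getElem?_append_left (by simpa using hj)]
  simp [hj]

theorem nextComma_iff {x s : List Γ'} {r k : ℕ} (h : x.drop (r + 1) = encodeNumber k ++ s) (e : ℕ) :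
    NextComma x r e ↔ e = r + (Nat.bits k).length + 1 := by
  have hlt : ∀ {j : ℕ}, j < (Nat.bits k).length → x[r + j + 1]? ≠ some .comma := fun hj => by
    rw [getElem?_of_drop h, encodeNumber_getElem?_of_lt s hj]
    simp
  have heq : x[r + (Nat.bits k).length + 1]? = some .comma := by
    rw [getElem?_of_drop h, encodeNumber_getElem?_length]
  have hlen := (List.getElem?_eq_some_iff.1 heq).1
  constructor
  · rintro ⟨hre, he, hbetween⟩
    obtain ⟨j, rfl⟩ := Nat.exists_eq_add_of_lt hre
    rcases lt_trichotomy j (Nat.bits k).length with hj | rfl | hj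
    · exact absurd he (hlt hj)
    · rfl
    · exact absurd heq (hbetween _ hlen.le (by omega) (by omega))
  · rintro rfl
    refine ⟨by omega, heq, fun y _ hry hy => ?_⟩
    obtain ⟨j, rfl⟩ := Nat.exists_eq_add_of_lt hry
    exact hlt (by omega)

theorem sameNumber_iff {x s s' : List Γ'} {r t k l : ℕ}
    (hr : x.drop (r + 1) = encodeNumber k ++ s) (ht : x.drop (t + 1) = encodeNumber l ++ s') :
    SameNumber x r t ↔ k = l := by
  have heq : x[r + (Nat.bits k).length + 1]? = some .comma := by
    rw [getElem?_of_drop hr, encodeNumber_getElem?_length]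
  have hlen := (List.getElem?_eq_some_iff.1 heq).1
  constructor
  · intro h
    have hagree : ∀ d ≤ (Nat.bits k).length,
        (encodeNumber k ++ s)[d]? = (encodeNumber l ++ s')[d]? := by
      intro d hd
      rw [← getElem?_of_drop hr, ← getElem?_of_drop ht]
      refine Option.ext fun c => h d (by omega) (fun e _ he => ?_) c
      rw [getElem?_of_drop hr, encodeNumber_getElem?_of_lt s (by omega)]
      simp
    have hle : (Nat.bits l).length = (Nat.bits k).length := by
      rcases lt_trichotomy (Nat.bits l).length (Nat.bits k).length with hlt | he | hlt
      · have := hagree _ hlt.le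
        rw [encodeNumber_getElem?_of_lt s hlt, encodeNumber_getElem?_length] at this
        simp at this
      · exact he
      · have := hagree _ le_rfl
        rw [encodeNumber_getElem?_of_lt s' hlt, encodeNumber_getElem?_length] at this
        simp at this
    have hbits : Nat.bits k = Nat.bits l := by
      refine List.ext_getElem hle.symm fun d hd hd' => ?_
      have := hagree d hd.le
      rw [encodeNumber_getElem?_of_lt s hd, encodeNumber_getElem?_of_lt s' hd'] at this
      simpa using this
    exact Nat.digits.injective 2 (by rw [Nat.digits_two_eq_bits, hbits, Nat.digits_two_eq_bits])
  · rintro rfl d _ hd c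
    have hdk : d ≤ (Nat.bits k).length := by
      by_contra hlt
      exact hd _ (by omega) (not_le.1 hlt) heq
    rw [getElem?_of_drop hr, getElem?_of_drop ht, List.getElem?_append_left,
      List.getElem?_append_left] <;> simp [encodeNumber] <;> omega

/-- Numbers that follow each other are found by `FieldStart`. -/
theorem exists_fieldStart_iff {x s : List Γ'} {b : ℕ} {ks : List ℕ}
    (h : x.drop (b + 1) = ks.flatMap encodeNumber ++ s) (i : ℕ) (hi : i < ks.length) :
    ∃ r ≤ x.length, x.drop (r + 1) = (ks.drop i).flatMap encodeNumber ++ s ∧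
      ∀ y, FieldStart x i b y ↔ y = r := by
  have hnum : ∀ (r i : ℕ) (hi : i < ks.length),
      x.drop (r + 1) = (ks.drop i).flatMap encodeNumber ++ s → x.drop (r + 1) =
        encodeNumber ks[i] ++ ((ks.drop (i + 1)).flatMap encodeNumber ++ s) := by
    intro r i hi hr
    rw [hr, List.drop_eq_getElem_cons hi, List.flatMap_cons, List.append_assoc]
  induction i with
  | zero =>
    refine ⟨b, ?_, by simpa using h, fun y => eq_comm⟩
    by_contra hb
    have := hnum b 0 hi (by simpa using h)
    rw [List.drop_eq_nil_of_le (by omega)] at this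
    simp [encodeNumber] at this
  | succ i ih =>
    obtain ⟨r, hr, hdrop, hiff⟩ := ih (by omega)
    have hdrop' := hnum r i (by omega) hdrop
    have hnext := nextComma_iff hdrop'
    have hcomma : x[r + (Nat.bits ks[i]).length + 1]? = some .comma := by
      rw [getElem?_of_drop hdrop', encodeNumber_getElem?_length]
    refine ⟨r + (Nat.bits ks[i]).length + 1, (List.getElem?_eq_some_iff.1 hcomma).1.le, ?_,
      fun y => ?_⟩
    · have : r + (Nat.bits ks[i]).length + 1 + 1 = r + 1 + (encodeNumber ks[i]).length := by
        simp [encodeNumber]; omega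
      rw [this, ← List.drop_drop, hdrop', List.drop_left]
    · simp only [FieldStart, hiff]
      constructor
      · rintro ⟨_, _, rfl, hy⟩
        exact (hnext y).1 hy
      · rintro rfl
        exact ⟨r, hr, rfl, (hnext _).2 rfl⟩

theorem sameField_iff {x s s' : List Γ'} {b c : ℕ} {ks ls : List ℕ}
    (hb : x.drop (b + 1) = ks.flatMap encodeNumber ++ s)
    (hc : x.drop (c + 1) = ls.flatMap encodeNumber ++ s') {i j : ℕ} (hi : i < ks.length)
    (hj : j < ls.length) : SameField x i b j c ↔ ks[i] = ls[j] := by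
  obtain ⟨r, hr, hdr, hir⟩ := exists_fieldStart_iff hb i hi
  obtain ⟨t, ht, hdt, hit⟩ := exists_fieldStart_iff hc j hj
  rw [List.drop_eq_getElem_cons hi, List.flatMap_cons, List.append_assoc] at hdr
  rw [List.drop_eq_getElem_cons hj, List.flatMap_cons, List.append_assoc] at hdt
  rw [← sameNumber_iff hdr hdt]
  refine ⟨fun h => h r hr t ht ((hir r).2 rfl) ((hit t).2 rfl), fun h r' _ t' _ hr' ht' => ?_⟩
  rw [(hir r').1 hr', (hit t').1 ht']
  exact h

/-- In a concatenation of words each of which has the letter `a` exactly at its beginning, this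
letter occurs only where one of these words starts. -/
theorem exists_drop_flatMap {α ι : Type*} {a : α} {g : ι → List α} (hg : ∀ i, a ∉ g i) :
    ∀ (L : List ι) (j : ℕ), (L.flatMap fun i => a :: g i)[j]? = some a →
      ∃ i, ∃ s, (L.flatMap fun i => a :: g i).drop j = a :: g i ++ s := by
  intro L
  induction L with
  | nil => intro j hj; simp at hj
  | cons i L ih =>
    intro j hj
    rw [List.flatMap_cons] at hj ⊢
    rcases lt_or_ge j (a :: g i).length with hlt | hge
    · rw [List.getElem?_append_left hlt] at hj
      cases j with
      | zero => exact ⟨i, _, rfl⟩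
      | succ j =>
        rw [List.getElem?_cons_succ] at hj
        exact absurd (List.mem_of_getElem? hj) (hg i)
    · rw [List.getElem?_append_right hge] at hj
      obtain ⟨i', s, h⟩ := ih _ hj
      exact ⟨i', s, by rw [List.drop_append, List.drop_eq_nil_of_le hge, List.nil_append, h]⟩

theorem bra_notMem_encodeNumber (k : ℕ) : Γ'.bra ∉ encodeNumber k := by
  simp [encodeNumber]

/-- The transitions of an encoded DFA, after the header. -/
theorem encodeDFA_eq {m n : ℕ} (A : DFA (Fin m) (Fin n)) :
    ∃ H F : List Γ', Γ'.bra ∉ H ∧ Γ'.bra ∉ F ∧ encodeDFA A = H ++ Γ'.bra :: F ++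
      ((List.finRange n).flatMap fun p => (List.finRange m).map fun a => (p, a)).flatMap
        fun i : Fin n × Fin m => Γ'.bra ::
          ([(i.1 : ℕ), (i.2 : ℕ), (A.step i.1 i.2 : ℕ)].flatMap encodeNumber ++ [Γ'.ket]) := by
  classical
  refine ⟨encodeNumber n ++ encodeNumber m ++ encodeNumber A.start,
    ((List.finRange n).filter fun q : Fin n => decide (q ∈ A.accept)).flatMap
      (fun q : Fin n => encodeNumber q) ++ [Γ'.ket], ?_, ?_, ?_⟩
  · simp [bra_notMem_encodeNumber]
  · simp [bra_notMem_encodeNumber]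
  · rw [List.flatMap_assoc]
    simp [encodeDFA, List.flatMap_map]

theorem isItem_encodeDFA {m n : ℕ} (A : DFA (Fin m) (Fin n)) {b : ℕ}
    (hb : IsItem (encodeDFA A) b) : ∃ (p : Fin n) (a : Fin m) (s : List Γ'), (encodeDFA A).drop (b + 1) =
      [(p : ℕ), (a : ℕ), (A.step p a : ℕ)].flatMap encodeNumber ++ s := by
  obtain ⟨H, F, hH, hF, heq⟩ := encodeDFA_eq A
  rw [heq] at hb ⊢
  obtain ⟨hb, y, -, hy, hyb⟩ := hb
  have hHy : H.length ≤ y := by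
    by_contra hlt
    rw [List.append_assoc, List.getElem?_append_left (not_le.1 hlt)] at hy
    exact hH (List.mem_of_getElem? hy)
  have hge : (H ++ Γ'.bra :: F).length ≤ b := by
    by_contra hlt
    rw [List.getElem?_append_left (not_le.1 hlt), List.getElem?_append_right (by omega),
      show b - H.length = b - H.length - 1 + 1 by omega, List.getElem?_cons_succ] at hb
    exact hF (List.mem_of_getElem? hb)
  rw [List.getElem?_append_right hge] at hb
  obtain ⟨i, s, hs⟩ := exists_drop_flatMap (fun i => by simp [bra_notMem_encodeNumber]) _ _ hb
  refine ⟨i.1, i.2, [Γ'.ket] ++ s, ?_⟩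
  rw [← List.drop_drop, List.drop_append, List.drop_eq_nil_of_le hge, List.nil_append, hs]
  simp

theorem exists_isItem_encodeDFA {m n : ℕ} (A : DFA (Fin m) (Fin n)) (p : Fin n) (a : Fin m) :
    ∃ b ≤ (encodeDFA A).length, IsItem (encodeDFA A) b ∧ ∃ s, (encodeDFA A).drop (b + 1) =
      [(p : ℕ), (a : ℕ), (A.step p a : ℕ)].flatMap encodeNumber ++ s := by
  obtain ⟨H, F, -, -, heq⟩ := encodeDFA_eq A
  have hmem : (p, a) ∈ (List.finRange n).flatMap fun p => (List.finRange m).map fun a => (p, a) := by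
    simp
  obtain ⟨L₁, L₂, hL⟩ := List.mem_iff_append.1 hmem
  rw [hL, List.flatMap_append, List.flatMap_cons, ← List.append_assoc] at heq
  set P := H ++ Γ'.bra :: F ++ L₁.flatMap fun i : Fin n × Fin m => Γ'.bra ::
    ([(i.1 : ℕ), (i.2 : ℕ), (A.step i.1 i.2 : ℕ)].flatMap encodeNumber ++ [Γ'.ket]) with hP
  rw [heq]
  refine ⟨P.length, by simp, ⟨by simp, H.length, by simp [hP], ?_, by simp [hP]⟩, ?_⟩
  · simp [hP]
  · rw [← List.drop_drop, List.drop_left]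
    exact ⟨_, by simp only [List.cons_append, List.drop_succ_cons, List.drop_zero,
      List.append_assoc]; rfl⟩

theorem commutingIdempotents_encodeDFA {m n : ℕ} (A : DFA (Fin m) (Fin n)) :
    CommutingIdempotents (encodeDFA A) ↔
      (∀ (p q : Fin n) (a : Fin m), A.step p a = q → A.step q a = q) ∧
      (∀ (p : Fin n) (a b : Fin m), A.step (A.step p a) b = A.step (A.step p b) a) := by
  constructor
  · rintro ⟨h₁, h₂⟩
    constructor
    · rintro p _ a rfl
      obtain ⟨b, hb, hib, s, hs⟩ := exists_isItem_encodeDFA A p a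
      obtain ⟨c, hc, hic, t, ht⟩ := exists_isItem_encodeDFA A (A.step p a) a
      have := h₁ b hb c hc hib hic ((sameField_iff hs ht (by simp) (by simp)).2 rfl)
        ((sameField_iff hs ht (by simp) (by simp)).2 rfl)
      exact Fin.ext ((sameField_iff hs ht (by simp) (by simp)).1 this).symm
    · intro p a a'
      obtain ⟨b, hb, hib, s, hs⟩ := exists_isItem_encodeDFA A p a
      obtain ⟨c, hc, hic, t, ht⟩ := exists_isItem_encodeDFA A p a'
      obtain ⟨b', hb', hib', s', hs'⟩ := exists_isItem_encodeDFA A (A.step p a) a'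
      obtain ⟨c', hc', hic', t', ht'⟩ := exists_isItem_encodeDFA A (A.step p a') a
      have := h₂ b hb c hc b' hb' c' hc' hib hic hib' hic'
        ((sameField_iff hs ht (by simp) (by simp)).2 rfl)
        ((sameField_iff hs hs' (by simp) (by simp)).2 rfl)
        ((sameField_iff ht hs' (by simp) (by simp)).2 rfl)
        ((sameField_iff ht ht' (by simp) (by simp)).2 rfl)
        ((sameField_iff hs ht' (by simp) (by simp)).2 rfl)
      exact Fin.ext ((sameField_iff hs' ht' (by simp) (by simp)).1 this)
  · rintro ⟨h₁, h₂⟩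
    constructor
    · intro b _ c _ hb hc e₁ e₂
      obtain ⟨p, a, s, hs⟩ := isItem_encodeDFA A hb
      obtain ⟨q, a', t, ht⟩ := isItem_encodeDFA A hc
      obtain rfl : A.step p a = q := Fin.ext ((sameField_iff hs ht (by simp) (by simp)).1 e₁)
      obtain rfl : a = a' := Fin.ext ((sameField_iff hs ht (by simp) (by simp)).1 e₂)
      exact (sameField_iff hs ht (by simp) (by simp)).2
        (congrArg Fin.val (h₁ p _ a rfl).symm)
    · intro b _ c _ b' _ c' _ hb hc hb' hc' e₁ e₂ e₃ e₄ e₅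
      obtain ⟨p, a, s, hs⟩ := isItem_encodeDFA A hb
      obtain ⟨p', a', t, ht⟩ := isItem_encodeDFA A hc
      obtain ⟨q, a₁, s', hs'⟩ := isItem_encodeDFA A hb'
      obtain ⟨q', a₂, t', ht'⟩ := isItem_encodeDFA A hc'
      obtain rfl : p = p' := Fin.ext ((sameField_iff hs ht (by simp) (by simp)).1 e₁)
      obtain rfl : A.step p a = q := Fin.ext ((sameField_iff hs hs' (by simp) (by simp)).1 e₂)
      obtain rfl : a' = a₁ := Fin.ext ((sameField_iff ht hs' (by simp) (by simp)).1 e₃)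
      obtain rfl : A.step p a' = q' := Fin.ext ((sameField_iff ht ht' (by simp) (by simp)).1 e₄)
      obtain rfl : a = a₂ := Fin.ext ((sameField_iff hs ht' (by simp) (by simp)).1 e₅)
      exact (sameField_iff hs' ht' (by simp) (by simp)).2 (congrArg Fin.val (h₂ p a a'))

end DFAEncoding

theorem mainTheorem6 :
    -- deciding whether a given minimal DFA recognizes a 1-PT language is in LOGSPACE
    (∃ P : Language Computability.Γ', InLOGSPACE P ∧
      ∀ (m n : ℕ) (A : DFA (Fin m) (Fin n)), A.IsMinimal →
        (encodeDFA A ∈ P ↔ IsPiecewiseTestable 1 A.accepts)) ∧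
    -- the characterization on which this rests
    (∀ {α σ : Type*} [Finite α] [Finite σ] (A : DFA α σ), A.IsMinimal →
      (IsPiecewiseTestable 1 A.accepts ↔
        (∀ (p q : σ) (a : α), A.step p a = q → A.step q a = q) ∧
        (∀ (p : σ) (a b : α), A.step (A.step p a) b = A.step (A.step p b) a))) := by
  refine ⟨⟨_, DFAEncoding.logDecidable_commutingIdempotents.inLOGSPACE, fun m n A hA => ?_⟩,
    fun A hA => hA.isPiecewiseTestable_one_iff⟩
  exact (DFAEncoding.commutingIdempotents_encodeDFA A).trans hA.isPiecewiseTestable_one_iff.symm
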